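/- Let $H_3=\mathbb R^3$ be the Heisenberg group of matrices $\begin{pmatrix}1&x^1&x^2\\0&1&x^3\\0&0&1\end{pmatrix}$, and let $\mathcal F$ be the left-invariant (singular, i.e. not $y$-global) Berwald–Moór Finsler metric on it induced by $\mathcal F_0(a)=(a^1a^2a^3)^{2/3}$ on the Lie algebra; in coordinates $$\mathcal F(x,y)=\bigl(y^1(y^2-x^1y^3)y^3\bigr)^{2/3},$$ where $t^{2/3}=\sqrt[3]{t^2}$. It is smooth on the open cones $\mathcal C_x=\{y: y^1(y^2-x^1y^3)y^3\neq 0\}$. Let $g_{ij}=\frac12\,\partial^2\mathcal F/\partial y^i\partial y^j$, $G^i=\frac14 g^{il}\bigl(2\,\partial g_{jl}/\partial x^k-\partial g_{jk}/\partial x^l\bigr)y^jy^k$ and $\Gamma^i_j=\partial G^i/\partial y^j$. A vector field $X(t)$ along a curve $c(t)$, with $X(t)\in\mathcal C_{c(t)}$, is parallel if $\dot X^i+\Gamma^i_j(c,X)\,\dot c^j=0$. Let $\mathfrak I_x=\{y\in T_xH_3:\mathcal F(x,y)=\pm1\}$ be the indicatrix at $x$, and let the holonomy group $\mathsf{Hol}(x)$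 be the subgroup of $\mathsf{Diff}^\infty(\mathfrak I_x)$ generated by (in fact, consisting of) the diffeomorphisms of $\mathfrak I_x$ given by parallel translation along piecewise $C^1$ closed curves from $x$ to $x$ (those curves along which parallel translation is a globally defined diffeomorphism of $\mathfrak I_x$). A smooth vector field $X$ on $\mathfrak I_x$ is called tangent to $\mathsf{Hol}(x)$ if there is a $C^1$ one-parameter family $\{\phi_t\in\mathsf{Hol}(x)\}_{t\in(-\varepsilon,\varepsilon)}$ with $\phi_0=\mathrm{Id}$ and $\frac{\partial\phi_t}{\partial t}\big|_{t=0}=X$; a Lie algebra of smooth vector fields on $\mathfrak I_x$ is tangent to $\mathsf{Hol}(x)$ if all its elements are. Then for every $x\in H_3$: 1. there is an infinite-dimensional Lie subalgebra of the Lie algebra $\mathfrak X^\infty(\mathfrak I_x)$ of smooth vector fields on $\mathfrak I_x$ that is tangent to $\mathsf{Hol}(x)$; 2. consequently $\mathsf{Hol}(x)$ is not a finite-dimensional Lie transformation group of $\mathfrak I_x$: the group $\mathsf{Hol}(x)$ carries no structure of a finite-dimensional (second countable) Lie group for which all the maps $\mathsf{Hol}(x)\to\mathfrak I_x$, $h\mapsto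 h(z)$, $z\in\mathfrak I_x$, are smooth. -/

import Mathlib

open scoped Manifold ContDiff

noncomputable section

/-! ## Smooth maps, functions, vector fields and diffeomorphisms of an embedded submanifold -/

section Submanifold

/-- Let `A` be (injected by `ι` as) a subset of the normed space `E`.  The map `f : A → F` is of
class `C^n` if every point of `A` has an open neighbourhood `U` in `E` such that `f` agrees on
`A ∩ U` with a map of class `C^n` defined on `U`. -/
def SmoothAlong {A E F : Type*} [NormedAddCommGroup E] [NormedSpace ℝ E]
    [NormedAddCommGroup F] [NormedSpace ℝ F] (n : ℕ∞ω) (ι : A → E) (f : A → F) : Prop :=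
  ∀ a : A, ∃ U : Set E, IsOpen U ∧ ι a ∈ U ∧
    ∃ g : E → F, ContDiffOn ℝ n g U ∧ ∀ b : A, ι b ∈ U → g (ι b) = f b

variable {E : Type*} [NormedAddCommGroup E] [NormedSpace ℝ E]

/-- The algebra `C^∞(S)` of smooth real functions on a submanifold `S` of `E`. -/
def smoothFunctions (S : Set E) : Subalgebra ℝ (S → ℝ) where
  carrier := {f | SmoothAlong ∞ (fun z : S => (z : E)) f}
  mul_mem' := by
    intro f f' hf hf' a
    obtain ⟨U, hU, haU, g, hg, hgf⟩ := hf a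
    obtain ⟨U', hU', haU', g', hg', hgf'⟩ := hf' a
    refine ⟨U ∩ U', hU.inter hU', ⟨haU, haU'⟩, fun v => g v * g' v,
      (hg.mono Set.inter_subset_left).mul (hg'.mono Set.inter_subset_right), ?_⟩
    intro b hb
    simp [hgf b hb.1, hgf' b hb.2]
  add_mem' := by
    intro f f' hf hf' a
    obtain ⟨U, hU, haU, g, hg, hgf⟩ := hf a
    obtain ⟨U', hU', haU', g', hg', hgf'⟩ := hf' a
    refine ⟨U ∩ U', hU.inter hU', ⟨haU, haU'⟩, fun v => g v + g' v,
      (hg.mono Set.inter_subset_left).add (hg'.mono Set.inter_subset_right), ?_⟩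
    intro b hb
    simp [hgf b hb.1, hgf' b hb.2]
  algebraMap_mem' := by
    intro r a
    exact ⟨Set.univ, isOpen_univ, Set.mem_univ _, fun _ => r, contDiffOn_const, fun b _ => rfl⟩

/-- The Lie algebra of smooth vector fields on a submanifold `S`, realised as the derivations of
`C^∞(S)`, with the commutator bracket. -/
abbrev VectorFields (S : Set E) : Type _ :=
  Derivation ℝ (smoothFunctions S) (smoothFunctions S)

/-- The group of smooth diffeomorphisms of a submanifold `S`. -/
def diffeoGroup (S : Set E) : Subgroup (Equiv.Perm S) where
  carrier := {h | SmoothAlong ∞ (fun z : S => (z : E)) (fun z => ((h z : S) : E)) ∧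
    SmoothAlong ∞ (fun z : S => (z : E)) (fun z => ((h⁻¹ z : S) : E))}
  one_mem' := by
    have h : SmoothAlong ∞ (fun z : S => (z : E)) (fun z : S => (z : E)) := fun a =>
      ⟨Set.univ, isOpen_univ, Set.mem_univ _, fun v => v, contDiffOn_id, fun b _ => rfl⟩
    exact ⟨by simpa using h, by simpa using h⟩
  inv_mem' := by
    rintro h ⟨h1, h2⟩
    exact ⟨h2, by simpa using h1⟩
  mul_mem' := by
    have key : ∀ h k : Equiv.Perm S,
        SmoothAlong ∞ (fun z : S => (z : E)) (fun z => ((h z : S) : E)) →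
        SmoothAlong ∞ (fun z : S => (z : E)) (fun z => ((k z : S) : E)) →
        SmoothAlong ∞ (fun z : S => (z : E)) (fun z => (((h * k) z : S) : E)) := by
      intro h k hh hk a
      obtain ⟨U, hU, haU, g, hg, hgf⟩ := hk a
      obtain ⟨U', hU', haU', g', hg', hgf'⟩ := hh (k a)
      refine ⟨U ∩ g ⁻¹' U', hg.continuousOn.isOpen_inter_preimage hU hU', ⟨haU, ?_⟩,
        fun v => g' (g v), ?_, ?_⟩
      · have := hgf a haU
        simp only [Set.mem_preimage, this]
        exact haU'
      · exact hg'.comp (hg.mono Set.inter_subset_left) (fun v hv => hv.2)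
      · rintro b ⟨hb1, hb2⟩
        have e := hgf b hb1
        have hb2' : g (b : E) ∈ U' := hb2
        rw [e] at hb2'
        have e' := hgf' (k b) hb2'
        simp only [e, e', Equiv.Perm.mul_apply]
    rintro h k ⟨h1, h2⟩ ⟨k1, k2⟩
    refine ⟨key h k h1 k1, ?_⟩
    rw [mul_inv_rev]
    exact key _ _ k2 h2

/-- The vector field `X` on `S` is tangent to the subgroup `H` of diffeomorphisms of `S`: there
is a `C^1` one-parameter family `φ t ∈ H`, `|t| < ε`, with `φ 0 = id` and
`∂(φ t)/∂t = X` at `t = 0`. -/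
def IsTangentTo {S : Set E} (H : Subgroup (Equiv.Perm S)) (X : VectorFields S) : Prop :=
  ∃ ε : ℝ, 0 < ε ∧ ∃ φ : ℝ → Equiv.Perm S,
    (∀ t ∈ Set.Ioo (-ε) ε, φ t ∈ H) ∧ φ 0 = 1 ∧
    SmoothAlong 1 (fun p : Set.Ioo (-ε) ε × S => ((p.1 : ℝ), (p.2 : E)))
      (fun p => ((φ p.1 p.2 : S) : E)) ∧
    ∀ (f : smoothFunctions S) (z : S),
      HasDerivAt (fun t => (f : S → ℝ) (φ t z)) ((X f : S → ℝ) z) 0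

/-- A Lie algebra of vector fields is tangent to `H` if all its elements are. -/
def IsTangentLieAlgebra {S : Set E} (H : Subgroup (Equiv.Perm S))
    (𝔤 : LieSubalgebra ℝ (VectorFields S)) : Prop :=
  ∀ X ∈ 𝔤, IsTangentTo H X

/-- The group `H` of transformations of `S ⊆ E` is a finite-dimensional Lie transformation group:
it carries the structure of a finite-dimensional (second countable) Lie group such that
`h ↦ h z` is smooth for every `z ∈ S`. -/
def IsLieTransformationGroup {S : Set E} (H : Subgroup (Equiv.Perm S)) : Prop :=
  ∃ (d : ℕ) (_ : TopologicalSpace H) (_ : ChartedSpace (EuclideanSpace ℝ (Fin d)) H),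
    SecondCountableTopology H ∧ LieGroup (𝓡 d) ∞ H ∧
    ∀ z : S, ContMDiff (𝓡 d) 𝓘(ℝ, E) ∞ (fun h : H => (((h : Equiv.Perm S) z : S) : E))

end Submanifold

/-! ## Finsler metrics on `ℝⁿ` (one global chart), parallel translation and holonomy

`F x y` is the metric, homogeneous of degree two in the tangent vector `y` at `x`, and the open
cones `C x` consist of the tangent vectors near which `F` is smooth. -/

section Finsler

variable {n : ℕ}

/-- `g_{ij}(x,y) = ½ ∂²F/∂yⁱ∂yʲ`. -/
def fundTensor (F : (Fin n → ℝ) → (Fin n → ℝ) → ℝ) (x y : Fin n → ℝ) :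
    Matrix (Fin n) (Fin n) ℝ :=
  Matrix.of fun i j =>
    (1 / 2) * lineDeriv ℝ (fun v => lineDeriv ℝ (F x) v (Pi.single j 1)) y (Pi.single i 1)

/-- The geodesic coefficients
`Gⁱ = ¼ g^{il} (2 ∂g_{jl}/∂xᵏ - ∂g_{jk}/∂xˡ) yʲ yᵏ`. -/
def geodesicCoeff (F : (Fin n → ℝ) → (Fin n → ℝ) → ℝ) (x y : Fin n → ℝ) : Fin n → ℝ :=
  fun i => (1 / 4) * ∑ l, ∑ j, ∑ k, (fundTensor F x y)⁻¹ i l *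
    (2 * lineDeriv ℝ (fun u => fundTensor F u y j l) x (Pi.single k 1) -
      lineDeriv ℝ (fun u => fundTensor F u y j k) x (Pi.single l 1)) * y j * y k

/-- The connection coefficients `Γⁱⱼ = ∂Gⁱ/∂yʲ`. -/
def connCoeff (F : (Fin n → ℝ) → (Fin n → ℝ) → ℝ) (x y : Fin n → ℝ) (i j : Fin n) : ℝ :=
  lineDeriv ℝ (fun v => geodesicCoeff F x v i) y (Pi.single j 1)

/-- `X` is a parallel vector field along the curve `c : [0,1] → ℝⁿ`: it stays in the cones and
`dXⁱ/dt + Γⁱⱼ(c,X) dcʲ/dt = 0` on `[0,1]` (one-sided derivatives at the endpoints). -/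
def IsParallelAlong (F : (Fin n → ℝ) → (Fin n → ℝ) → ℝ) (C : (Fin n → ℝ) → Set (Fin n → ℝ))
    (c X : ℝ → Fin n → ℝ) : Prop :=
  ∀ t ∈ Set.Icc (0 : ℝ) 1, X t ∈ C (c t) ∧
    HasDerivWithinAt X
      (fun i => -∑ j, connCoeff F (c t) (X t) i j * derivWithin c (Set.Icc 0 1) t j)
      (Set.Icc 0 1) t

/-- A piecewise differentiable curve is given by the list of its `C^1` pieces, each of them
parametrised by `[0,1]`.  `JoinsPoints cs p q` says that the pieces `cs` form a curve from `p`
to `q` (the constant curve if the list is empty). -/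
def JoinsPoints : List (ℝ → Fin n → ℝ) → (Fin n → ℝ) → (Fin n → ℝ) → Prop
  | [], p, q => p = q
  | c :: cs, p, q => ContDiffOn ℝ 1 c (Set.Icc 0 1) ∧ c 0 = p ∧ JoinsPoints cs (c 1) q

/-- Parallel translation along the piecewise differentiable curve with pieces `cs` takes the
vector `v` to the vector `w`. -/
def Translates (F : (Fin n → ℝ) → (Fin n → ℝ) → ℝ) (C : (Fin n → ℝ) → Set (Fin n → ℝ)) :
    List (ℝ → Fin n → ℝ) → (Fin n → ℝ) → (Fin n → ℝ) → Prop
  | [], v, w => v = w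
  | c :: cs, v, w => ∃ X : ℝ → Fin n → ℝ,
      IsParallelAlong F C c X ∧ X 0 = v ∧ Translates F C cs (X 1) w

/-- The indicatrix at `x`. -/
def indicatrix (F : (Fin n → ℝ) → (Fin n → ℝ) → ℝ) (x : Fin n → ℝ) : Set (Fin n → ℝ) :=
  {y | F x y = 1 ∨ F x y = -1}

/-- The holonomy group at `x`: the group of diffeomorphisms of the indicatrix at `x` given by
parallel translation along the piecewise differentiable closed curves from `x` to `x` (those along
which parallel translation is a globally defined diffeomorphism of the indicatrix). -/
def holonomyGroup (F : (Fin n → ℝ) → (Fin n → ℝ) → ℝ) (C : (Fin n → ℝ) → Set (Fin n → ℝ))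
    (x : Fin n → ℝ) : Subgroup (Equiv.Perm (indicatrix F x)) :=
  Subgroup.closure {h | h ∈ diffeoGroup (indicatrix F x) ∧
    ∃ cs : List (ℝ → Fin n → ℝ), JoinsPoints cs x x ∧
      ∀ z : indicatrix F x, Translates F C cs z (h z)}

end Finsler

/-! ## The Heisenberg group with its left-invariant Berwald–Moór metric -/

section Heisenberg

/-- The Heisenberg matrix with coordinates `x = (x¹, x², x³)`. -/
def heisMatrix (x : Fin 3 → ℝ) : Matrix (Fin 3) (Fin 3) ℝ :=
  !![1, x 0, x 1; 0, 1, x 2; 0, 0, 1]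

/-- Multiplication of the Heisenberg group in these coordinates. -/
def heisMul (x y : Fin 3 → ℝ) : Fin 3 → ℝ :=
  ![x 0 + y 0, x 1 + y 1 + x 0 * y 2, x 2 + y 2]

/-- Inversion of the Heisenberg group. -/
def heisInv (x : Fin 3 → ℝ) : Fin 3 → ℝ :=
  ![-x 0, x 0 * x 2 - x 1, -x 2]

lemma heisMatrix_mul (x y : Fin 3 → ℝ) :
    heisMatrix (heisMul x y) = heisMatrix x * heisMatrix y := by
  ext i j
  fin_cases i <;> fin_cases j <;>
    simp [heisMatrix, heisMul, Matrix.mul_apply, Fin.sum_univ_three] <;> ring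

lemma heisMul_inv_left (x : Fin 3 → ℝ) : heisMul (heisInv x) x = 0 := by
  ext i
  fin_cases i <;> simp [heisMul, heisInv]

/-- The Berwald–Moór functional `(a¹a²a³)^{2/3}` on the Lie algebra, the power being the (real)
cube root of the square. -/
def berwaldMoor (a : Fin 3 → ℝ) : ℝ := ((a 0 * a 1 * a 2) ^ 2) ^ (1 / 3 : ℝ)

/-- The left-invariant Berwald–Moór metric `F(x,y) = F₀(x⁻¹y)`, where `x⁻¹y` is the image of the
tangent vector `y` at `x` under the differential of the left translation by `x⁻¹`. -/
def heisMetric (x y : Fin 3 → ℝ) : ℝ :=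
  berwaldMoor (fderiv ℝ (heisMul (heisInv x)) x y)

/-- The open cone of all tangent vectors at `x` near which the metric is smooth. -/
def heisCone (x : Fin 3 → ℝ) : Set (Fin 3 → ℝ) :=
  {y | y 0 * (y 1 - x 0 * y 2) * y 2 ≠ 0}

/-- The coordinate expression of the metric. -/
lemma heisMetric_eq (x y : Fin 3 → ℝ) :
    heisMetric x y = ((y 0 * (y 1 - x 0 * y 2) * y 2) ^ 2) ^ (1 / 3 : ℝ) := by
  have h : HasFDerivAt (heisMul (heisInv x))
      (ContinuousLinearMap.pi
        ![ContinuousLinearMap.proj 0,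
          ContinuousLinearMap.proj 1 - x 0 • ContinuousLinearMap.proj 2,
          ContinuousLinearMap.proj 2] : (Fin 3 → ℝ) →L[ℝ] (Fin 3 → ℝ)) x := by
    have p : ∀ i : Fin 3, HasFDerivAt (fun v : Fin 3 → ℝ => v i)
        (ContinuousLinearMap.proj i : (Fin 3 → ℝ) →L[ℝ] ℝ) x := fun i => hasFDerivAt_apply i x
    rw [hasFDerivAt_pi']
    intro i
    fin_cases i
    · refine ((p 0).const_add (heisInv x 0)).congr_fderiv ?_
      ext v; simp
    · refine (((p 1).const_add (heisInv x 1)).add ((p 2).const_mul (heisInv x 0))).congr_fderiv ?_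
      ext v; simp [heisInv]; ring
    · refine ((p 2).const_add (heisInv x 2)).congr_fderiv ?_
      ext v; simp
  rw [heisMetric, h.fderiv]
  simp [berwaldMoor]

end Heisenberg

end

/-! Write a tangent vector in left-invariant components a = y⁰, b = y¹ - x⁰y², c = y² (indices as in
the code) and put u = c/b, v = a/b. Parallel translation along the coordinate lines in directions 0
and 1 can be solved explicitly. Along the first, u is constant and a, b, c are multiplied by
exp(su), exp(-su/2), exp(-su/2). Along the second, uv and b are constant and a, c are multiplied by
exp(-suv/2), exp(suv/2). These formulas do not involve the base point, and displacements along
coordinate lines commute, so every group commutator of the two flows is translation along a closed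
curve from any point (`IsTransport.commutator`). It therefore belongs to the holonomy group, and so
do further commutators of it with the first flow.

On the infinitesimal level the generators X₁, X₂ satisfy X₁u = 0, X₁v = (3/2)uv and X₂u = (1/2)u²v.
Hence the n-fold bracket of X₂ with X₁ sends u to a nonzero multiple of uⁿ⁺²v
(`iterField_ratioOne`). These functions are linearly independent on the indicatrix, so the brackets
are linearly independent too.

A commutator of smooth families has the form id + sᵏX + O(sᵏ⁺¹) with k > 1, so its bracket becomes a
velocity only after the substitution s = t^(1/k). This gives a C¹ family on both sides of t = 0 when
k is odd. The leading terms of odd order of smooth families in a group form a Lie algebra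
(`leadingTerms`), all of it tangent (`HasLeadingTerm.isTangentTo`). For the holonomy group it
contains the brackets above, which proves the first claim.

For the second claim, d + 1 independent tangent fields yield a (d + 1)-parameter family of group
elements. Finitely many evaluations of it, followed by a linear map, fill an open subset of ℝᵈ⁺¹. On
a d-dimensional Lie group with smooth evaluations, the same values would form a set of Hausdorff
dimension at most d (`ContMDiff.dimH_range_le`, `not_isLieTransformationGroup`). -/

open Set Filter Topology MeasureTheory

universe u

/-! ## Smoothness along an injected subset -/

section SmoothAlong

variable {A A' E E' F G : Type*} [NormedAddCommGroup E] [NormedSpace ℝ E]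
  [NormedAddCommGroup E'] [NormedSpace ℝ E'] [NormedAddCommGroup F] [NormedSpace ℝ F]
  [NormedAddCommGroup G] [NormedSpace ℝ G] {n : ℕ∞ω} {ι : A → E} {ι' : A' → E'}

theorem ContDiff.smoothAlong {g : E → F} (hg : ContDiff ℝ n g) (ι : A → E) :
    SmoothAlong n ι (fun a => g (ι a)) := fun _ =>
  ⟨univ, isOpen_univ, mem_univ _, g, hg.contDiffOn, fun _ _ => rfl⟩

theorem SmoothAlong.comp {f : A → F} (hf : SmoothAlong n ι f) {k : A' → A}
    (hk : SmoothAlong n ι' (fun a => ι (k a))) : SmoothAlong n ι' (fun a => f (k a)) := by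
  intro a
  obtain ⟨U, hU, haU, g, hg, hgf⟩ := hk a
  obtain ⟨U', hU', haU', g', hg', hgf'⟩ := hf (k a)
  refine ⟨U ∩ g ⁻¹' U', hg.continuousOn.isOpen_inter_preimage hU hU', ⟨haU, ?_⟩,
    fun v => g' (g v), hg'.comp (hg.mono inter_subset_left) (fun v hv => hv.2), ?_⟩
  · simpa only [mem_preimage, hgf a haU] using haU'
  · rintro b ⟨hb1, hb2⟩
    have hb2' : g (ι' b) ∈ U' := hb2
    simp only [hgf b hb1] at hb2' ⊢
    exact hgf' _ hb2'

theorem ContDiff.comp_smoothAlong {g : F → G} (hg : ContDiff ℝ n g) {f : A → F}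
    (hf : SmoothAlong n ι f) : SmoothAlong n ι (fun a => g (f a)) :=
  SmoothAlong.comp (hg.smoothAlong (id : F → F)) hf

theorem SmoothAlong.prodMk {f : A → F} {g : A → G} (hf : SmoothAlong n ι f)
    (hg : SmoothAlong n ι g) : SmoothAlong n ι (fun a => (f a, g a)) := by
  intro a
  obtain ⟨U, hU, haU, f', hf', hff⟩ := hf a
  obtain ⟨V, hV, haV, g', hg', hgg⟩ := hg a
  exact ⟨U ∩ V, hU.inter hV, ⟨haU, haV⟩, fun v => (f' v, g' v),
    (hf'.mono inter_subset_left).prodMk (hg'.mono inter_subset_right),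
    fun b hb => Prod.ext (hff b hb.1) (hgg b hb.2)⟩

theorem SmoothAlong.add {f g : A → F} (hf : SmoothAlong n ι f)
    (hg : SmoothAlong n ι g) : SmoothAlong n ι (fun a => f a + g a) :=
  (contDiff_fst.add contDiff_snd).comp_smoothAlong (hf.prodMk hg)

theorem SmoothAlong.sub {f g : A → F} (hf : SmoothAlong n ι f)
    (hg : SmoothAlong n ι g) : SmoothAlong n ι (fun a => f a - g a) :=
  (contDiff_fst.sub contDiff_snd).comp_smoothAlong (hf.prodMk hg)

theorem SmoothAlong.mul {f g : A → ℝ} (hf : SmoothAlong n ι f)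
    (hg : SmoothAlong n ι g) : SmoothAlong n ι (fun a => f a * g a) :=
  (contDiff_fst.mul contDiff_snd).comp_smoothAlong (hf.prodMk hg)

theorem smoothAlong_pi {κ : Type*} [Fintype κ] {f : A → κ → ℝ}
    (hf : ∀ i, SmoothAlong n ι (fun a => f a i)) : SmoothAlong n ι f := by
  intro a
  choose U hU haU g hg hgf using fun i => hf i a
  refine ⟨⋂ i, U i, isOpen_iInter_of_finite hU, mem_iInter.2 haU, fun v i => g i v,
    contDiffOn_pi.2 fun i => (hg i).mono (iInter_subset _ i), fun b hb => ?_⟩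
  ext i
  exact hgf i b (mem_iInter.1 hb i)

end SmoothAlong

/-! ## Parametric integrals and Hadamard's lemma -/

section Hadamard

theorem hasFDerivAt_parametric_integral {E F : Type*} [NormedAddCommGroup E] [NormedSpace ℝ E]
    [ProperSpace E] [NormedAddCommGroup F] [NormedSpace ℝ F] [CompleteSpace F]
    {f : ℝ × E → F} (hf : ContDiff ℝ 1 f) (x : E) :
    HasFDerivAt (fun x => ∫ τ in (0 : ℝ)..1, f (τ, x))
      (∫ τ in (0 : ℝ)..1, (fderiv ℝ f (τ, x)).comp (ContinuousLinearMap.inr ℝ ℝ E)) x := by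
  have hc : Continuous fun p : ℝ × E =>
      (fderiv ℝ f p).comp (ContinuousLinearMap.inr ℝ ℝ E) :=
    (hf.continuous_fderiv one_ne_zero).clm_comp continuous_const
  obtain ⟨K, hK⟩ := ((isCompact_Icc (a := (0 : ℝ)) (b := 1)).prod
    (isCompact_closedBall x 1)).exists_bound_of_continuousOn hc.continuousOn
  refine intervalIntegral.hasFDerivAt_integral_of_dominated_of_fderiv_le
    (F := fun x τ => f (τ, x)) (bound := fun _ => K)
    (F' := fun x τ => (fderiv ℝ f (τ, x)).comp (ContinuousLinearMap.inr ℝ ℝ E))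
    (Metric.ball_mem_nhds x one_pos) ?_ ?_ ?_ ?_ ?_ ?_
  · exact Eventually.of_forall fun y =>
      (hf.continuous.comp (by fun_prop : Continuous fun τ : ℝ => (τ, y))).aestronglyMeasurable
  · exact (hf.continuous.comp
      (by fun_prop : Continuous fun τ : ℝ => (τ, x))).intervalIntegrable _ _
  · exact (hc.comp (by fun_prop : Continuous fun τ : ℝ => (τ, x))).aestronglyMeasurable
  · refine Eventually.of_forall fun τ hτ y hy => hK (τ, y) ⟨?_, Metric.ball_subset_closedBall hy⟩
    rw [uIoc_of_le zero_le_one] at hτ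
    exact ⟨hτ.1.le, hτ.2⟩
  · exact intervalIntegrable_const
  · refine Eventually.of_forall fun τ _ y _ => ?_
    have h1 : HasFDerivAt f (fderiv ℝ f (τ, y)) (τ, y) :=
      (hf.differentiable one_ne_zero _).hasFDerivAt
    exact h1.comp y (hasFDerivAt_prodMk_right τ y)

/-- The derivative of the integral is again a parametric integral, now with values in `E →L[ℝ] F`.
The induction must therefore vary `F`, and a single universe for `E` and `F` keeps it closed under
this passage. -/
theorem contDiff_parametric_integral_nat {E : Type u} [NormedAddCommGroup E] [NormedSpace ℝ E]
    [ProperSpace E] (n : ℕ) : ∀ {F : Type u} [NormedAddCommGroup F] [NormedSpace ℝ F]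
    [CompleteSpace F] {f : ℝ × E → F}, ContDiff ℝ ∞ f →
      ContDiff ℝ n (fun x => ∫ τ in (0 : ℝ)..1, f (τ, x)) := by
  induction n with
  | zero =>
    intro F _ _ _ f hf
    have h1 : ContDiff ℝ 1 f := hf.of_le (by simp)
    exact contDiff_zero.2 (continuous_iff_continuousAt.2 fun x =>
      (hasFDerivAt_parametric_integral h1 x).continuousAt)
  | succ n ih =>
    intro F _ _ _ f hf
    have h1 : ContDiff ℝ 1 f := hf.of_le (by simp)
    push_cast
    refine contDiff_succ_iff_hasFDerivAt.2 ⟨_, ih (f := fun p : ℝ × E =>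
      (fderiv ℝ f p).comp (ContinuousLinearMap.inr ℝ ℝ E)) ?_,
      fun x => hasFDerivAt_parametric_integral h1 x⟩
    exact (hf.fderiv_right (m := ∞) (by simp)).clm_comp contDiff_const

theorem contDiff_parametric_integral {E F : Type u} [NormedAddCommGroup E] [NormedSpace ℝ E]
    [ProperSpace E] [NormedAddCommGroup F] [NormedSpace ℝ F]
    [CompleteSpace F] {f : ℝ × E → F} (hf : ContDiff ℝ ∞ f) :
    ContDiff ℝ ∞ (fun x => ∫ τ in (0 : ℝ)..1, f (τ, x)) :=
  contDiff_infty.2 fun n => contDiff_parametric_integral_nat n hf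

/-- Multiplication by a bump function supported in `U` and equal to 1 near `a`. This supplies the
globally smooth integrands that parametric integration requires. -/
theorem ContDiffOn.exists_contDiff_eventuallyEq {E : Type*} [NormedAddCommGroup E]
    [NormedSpace ℝ E] [FiniteDimensional ℝ E] {g : E → ℝ} {U : Set E} (hU : IsOpen U)
    (hg : ContDiffOn ℝ ∞ g U) {a : E} (ha : a ∈ U) :
    ∃ g' : E → ℝ, ContDiff ℝ ∞ g' ∧ g' =ᶠ[𝓝 a] g := by
  obtain ⟨f, hfU, -, hf, -, hfa⟩ : ∃ f : E → ℝ, tsupport f ⊆ U ∧ HasCompactSupport f ∧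
      ContDiff ℝ ∞ f ∧ range f ⊆ Icc 0 1 ∧ f =ᶠ[𝓝 a] 1 := by
    obtain ⟨r, hr, hrU⟩ := Metric.isOpen_iff.1 hU a ha
    let b : ContDiffBump a := ⟨r / 4, r / 2, by linarith, by linarith⟩
    refine ⟨b, ?_, b.hasCompactSupport, b.contDiff, ?_, b.eventuallyEq_one⟩
    · rw [b.tsupport_eq]
      exact (Metric.closedBall_subset_ball (by change r / 2 < r; linarith)).trans hrU
    · rintro _ ⟨x, rfl⟩
      exact ⟨b.nonneg, b.le_one⟩
  refine ⟨fun x => f x * g x, contDiff_iff_contDiffAt.2 fun x => ?_, ?_⟩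
  · by_cases hx : x ∈ U
    · exact hf.contDiffAt.mul (hg.contDiffAt (hU.mem_nhds hx))
    · have h0 : (fun x => f x * g x) =ᶠ[𝓝 x] fun _ => 0 := by
        filter_upwards [(isClosed_tsupport f).isOpen_compl.mem_nhds fun h => hx (hfU h)] with y hy
        rw [image_eq_zero_of_notMem_tsupport hy, zero_mul]
      exact contDiffAt_const.congr_of_eventuallyEq h0
  · filter_upwards [hfa] with x hx
    simp [hx]

/-- The embedding of the product of the line and a subset of `E`. -/
def lineProd {E : Type*} (S : Set E) (p : ℝ × S) : ℝ × E := (p.1, p.2)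

variable {E : Type} [NormedAddCommGroup E] [NormedSpace ℝ E] {S : Set E}

theorem smoothAlong_initial {f : ℝ × S → ℝ} (hf : SmoothAlong ∞ (lineProd S) f) :
    SmoothAlong ∞ (fun z : S => (z : E)) (fun z => f (0, z)) :=
  hf.comp (contDiff_prodMk_right (0 : ℝ) |>.smoothAlong _)

/-- Hadamard's lemma. -/
theorem SmoothAlong.hadamard [FiniteDimensional ℝ E] {f : ℝ × S → ℝ} (hf : SmoothAlong ∞ (lineProd S) f) :
    ∃ g : ℝ × S → ℝ, SmoothAlong ∞ (lineProd S) g ∧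
      ∀ s z, f (s, z) = f (0, z) + s * g (s, z) := by
  -- The quotient is fixed pointwise as the divided slope, and smoothness is local: near s = 0 it is
  -- ∫₀¹ ∂ₛg'(τs, z) dτ for a global extension g', and away from s = 0 it is an honest quotient of
  -- smooth extensions.
  refine ⟨fun p => dslope (fun s => f (s, p.2)) 0 p.1, ?_, fun s z => ?_⟩
  · rintro ⟨s₀, z₀⟩
    by_cases hs : s₀ = 0
    · subst hs
      obtain ⟨U, hU, haU, g, hg, hgf⟩ := hf (0, z₀)
      obtain ⟨g', hg', hgg'⟩ := hg.exists_contDiff_eventuallyEq hU haU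
      have hev : ∀ᶠ p in 𝓝 (lineProd S (0, z₀)), p ∈ U ∧ g' p = g p :=
        (show ∀ᶠ p in _, p ∈ U from hU.mem_nhds haU).and hgg'
      obtain ⟨u, hu, v, hv, huv⟩ := (eventually_prod_iff.1
        (by simpa [lineProd, nhds_prod_eq] using hev : ∀ᶠ p in 𝓝 (0 : ℝ) ×ˢ 𝓝 (z₀ : E),
          p ∈ U ∧ g' p = g p))
      have hd : ContDiff ℝ ∞ fun p : ℝ × E => fderiv ℝ g' p (1, 0) :=
        (hg'.fderiv_right (m := ∞) (by simp)).clm_apply contDiff_const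
      have hk : ContDiff ℝ ∞ fun p : ℝ × E =>
          ∫ τ in (0 : ℝ)..1, fderiv ℝ g' (τ * p.1, p.2) (1, 0) :=
        contDiff_parametric_integral (f := fun q : ℝ × ℝ × E =>
          fderiv ℝ g' (q.1 * q.2.1, q.2.2) (1, 0)) (hd.comp (by fun_prop))
      have hline : ∀ (w : E) (s : ℝ), HasDerivAt (fun s => g' (s, w))
          (fderiv ℝ g' (s, w) (1, 0)) s := fun w s =>
        ((hg'.differentiable (by simp) (s, w)).hasFDerivAt).comp_hasDerivAt s
          ((hasDerivAt_id s).prodMk (hasDerivAt_const s w))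
      -- A product neighbourhood is needed because g' must agree with f at (0, z) as well as at (s,
      -- z). The segment between them may leave the neighbourhood, since g' is smooth everywhere.
      obtain ⟨u', hu', hu'o, hu0⟩ := eventually_nhds_iff.1 hu
      obtain ⟨v', hv', hv'o, hv0⟩ := eventually_nhds_iff.1 hv
      refine ⟨u' ×ˢ v', hu'o.prod hv'o, ⟨hu0, hv0⟩, _, hk.contDiffOn, ?_⟩
      rintro ⟨s, z⟩ ⟨hsu, hzv⟩
      have heq : ∀ s ∈ u', g' (s, (z : E)) = f (s, z) := fun s hs => by
        have := huv (hu' s hs) (hv' _ hzv)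
        exact this.2.trans (hgf (s, z) this.1)
      change (∫ τ in (0 : ℝ)..1, fderiv ℝ g' (τ * s, (z : E)) (1, 0)) =
        dslope (fun s => f (s, z)) 0 s
      rcases eq_or_ne s 0 with rfl | hs
      · have he : (fun s => f (s, z)) =ᶠ[𝓝 0] fun s => g' (s, (z : E)) := by
          filter_upwards [hu'o.mem_nhds hu0] with s hs using (heq s hs).symm
        simp [he.deriv_eq, (hline z 0).deriv]
      · rw [dslope_of_ne _ hs, slope_def_field, ← heq s hsu, ← heq 0 hu0]
        have h1 : ∀ τ ∈ uIcc (0 : ℝ) 1, HasDerivAt (fun τ => s⁻¹ * g' (τ * s, (z : E)))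
            (fderiv ℝ g' (τ * s, (z : E)) (1, 0)) τ := fun τ _ => by
          have := (((hline z (τ * s)).comp τ ((hasDerivAt_id τ).mul_const s)).const_mul s⁻¹)
          refine this.congr_deriv ?_
          field_simp
        rw [intervalIntegral.integral_eq_sub_of_hasDerivAt h1]
        · simp only [one_mul, zero_mul, sub_zero]
          field_simp
        · exact ((hd.continuous.comp
            (by fun_prop : Continuous fun τ : ℝ => (τ * s, (z : E)))).intervalIntegrable _ _)
    · obtain ⟨U, hU, haU, g, hg, hgf⟩ := hf (s₀, z₀)
      obtain ⟨V, hV, haV, g₀, hg₀, hgf₀⟩ := smoothAlong_initial hf z₀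
      refine ⟨U ∩ ({s | s ≠ 0} ×ˢ V), hU.inter (isOpen_ne.prod hV), ⟨haU, hs, haV⟩,
        fun p => (g p - g₀ p.2) / p.1, ?_, ?_⟩
      · refine ((hg.mono inter_subset_left).sub
          (hg₀.comp contDiffOn_snd fun p hp => hp.2.2)).div contDiffOn_fst fun p hp => hp.2.1
      · rintro ⟨s, z⟩ ⟨h1, h2, h3⟩
        change (g (lineProd S (s, z)) - g₀ z) / s = dslope (fun s => f (s, z)) 0 s
        rw [dslope_of_ne _ (show s ≠ 0 from h2), slope_def_field, hgf _ h1, hgf₀ _ h3, sub_zero]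
  · have h := sub_smul_dslope (fun s => f (s, z)) 0 s
    simp only [sub_zero, smul_eq_mul] at h
    rw [h]
    ring

end Hadamard

/-! ## Smooth one-parameter families of transformations and their leading terms -/

section Families

variable {E : Type} [NormedAddCommGroup E] [NormedSpace ℝ E] {S : Set E}

theorem SmoothAlong.contDiff_line {f : ℝ × S → ℝ} (hf : SmoothAlong ∞ (lineProd S) f) (z : S) :
    ContDiff ℝ ∞ fun s => f (s, z) := by
  refine contDiff_iff_contDiffAt.2 fun s => ?_
  obtain ⟨U, hU, haU, g, hg, hgf⟩ := hf (s, z)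
  have hc : ContDiff ℝ ∞ fun s : ℝ => (s, (z : E)) := contDiff_prodMk_left _
  refine ((hg.contDiffAt (hU.mem_nhds haU)).comp (f := fun s : ℝ => (s, (z : E))) s
    hc.contDiffAt).congr_of_eventuallyEq ?_
  filter_upwards [(hU.preimage hc.continuous).mem_nhds haU] with t ht
  exact (hgf (t, z) ht).symm

/-- A smooth family of diffeomorphisms, parametrised by the line and equal to the identity
at zero. -/
structure IsSmoothFamily (Φ : ℝ → Equiv.Perm S) : Prop where
  zero : Φ 0 = 1
  smooth : SmoothAlong ∞ (lineProd S) fun p => (Φ p.1 p.2 : E)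
  smooth_inv : SmoothAlong ∞ (lineProd S) fun p => ((Φ p.1)⁻¹ p.2 : E)

namespace IsSmoothFamily

variable {Φ Ψ : ℝ → Equiv.Perm S}

theorem lift (hΦ : IsSmoothFamily Φ) :
    SmoothAlong ∞ (lineProd S) fun p => lineProd S (p.1, Φ p.1 p.2) :=
  (contDiff_fst.smoothAlong _).prodMk hΦ.smooth

theorem inv (hΦ : IsSmoothFamily Φ) : IsSmoothFamily fun s => (Φ s)⁻¹ :=
  ⟨by simp [hΦ.zero], hΦ.smooth_inv, by simpa using hΦ.smooth⟩

theorem mul (hΦ : IsSmoothFamily Φ) (hΨ : IsSmoothFamily Ψ) :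
    IsSmoothFamily fun s => Φ s * Ψ s := by
  refine ⟨by simp [hΦ.zero, hΨ.zero], hΦ.smooth.comp hΨ.lift, ?_⟩
  simp only [mul_inv_rev]
  exact hΨ.smooth_inv.comp hΦ.inv.lift

theorem one : IsSmoothFamily (fun _ => 1 : ℝ → Equiv.Perm S) :=
  ⟨rfl, contDiff_snd.smoothAlong _, contDiff_snd.smoothAlong _⟩

theorem reparam (hΦ : IsSmoothFamily Φ) {r : ℝ → ℝ} (hr : ContDiff ℝ ∞ r) (h0 : r 0 = 0) :
    IsSmoothFamily fun s => Φ (r s) := by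
  have h : SmoothAlong ∞ (lineProd S) fun p => lineProd S (r p.1, p.2) :=
    (((hr.comp contDiff_fst).prodMk contDiff_snd).smoothAlong (lineProd S))
  exact ⟨by simp [h0, hΦ.zero], hΦ.smooth.comp h, hΦ.smooth_inv.comp h⟩

theorem pull (hΦ : IsSmoothFamily Φ) {f : ℝ × S → ℝ} (hf : SmoothAlong ∞ (lineProd S) f) :
    SmoothAlong ∞ (lineProd S) fun p => f (p.1, Φ p.1 p.2) :=
  hf.comp hΦ.lift

theorem pull_const (hΦ : IsSmoothFamily Φ) (f : smoothFunctions S) :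
    SmoothAlong ∞ (lineProd S) fun p => (f : S → ℝ) (Φ p.1 p.2) :=
  SmoothAlong.comp (k := fun p : ℝ × S => Φ p.1 p.2) f.2 hΦ.smooth

theorem mem_diffeoGroup (hΦ : IsSmoothFamily Φ) (s : ℝ) : Φ s ∈ diffeoGroup S :=
  have h : SmoothAlong ∞ (fun z : S => (z : E)) fun z => lineProd S (s, z) :=
    (contDiff_prodMk_right s).smoothAlong _
  ⟨hΦ.smooth.comp h, hΦ.smooth_inv.comp h⟩

theorem exists_first_order [FiniteDimensional ℝ E] (hΦ : IsSmoothFamily Φ)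
    (f : smoothFunctions S) :
    ∃ g : ℝ × S → ℝ, SmoothAlong ∞ (lineProd S) g ∧
      (∀ s z, (f : S → ℝ) (Φ s z) = (f : S → ℝ) z + s * g (s, z)) ∧
      ∀ z, HasDerivAt (fun s => (f : S → ℝ) (Φ s z)) (g (0, z)) 0 := by
  obtain ⟨g, hg, h⟩ := (hΦ.pull_const f).hadamard
  simp only [hΦ.zero, Equiv.Perm.one_apply] at h
  refine ⟨g, hg, h, fun z => ?_⟩
  simp only [h]
  have hd := (((hg.contDiff_line z).differentiable (by simp)) 0).hasDerivAt
  refine (((hasDerivAt_id (0 : ℝ)).mul hd).const_add ((f : S → ℝ) z)).congr_deriv ?_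
  simp

theorem differentiableAt_zero [FiniteDimensional ℝ E] (hΦ : IsSmoothFamily Φ)
    (f : smoothFunctions S) (z : S) :
    DifferentiableAt ℝ (fun s => (f : S → ℝ) (Φ s z)) 0 := by
  obtain ⟨g, -, -, h⟩ := hΦ.exists_first_order f
  exact (h z).differentiableAt

/-- The derivative of a smooth function along a smooth family at time zero. -/
noncomputable def derivativeMap [FiniteDimensional ℝ E] (hΦ : IsSmoothFamily Φ) :
    smoothFunctions S →ₗ[ℝ] smoothFunctions S where
  toFun f := ⟨fun z => deriv (fun s => (f : S → ℝ) (Φ s z)) 0, by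
    obtain ⟨g, hg, -, h⟩ := hΦ.exists_first_order f
    simp only [(h _).deriv]
    exact smoothAlong_initial hg⟩
  map_add' f g := Subtype.ext <| funext fun z =>
    deriv_fun_add (hΦ.differentiableAt_zero f z) (hΦ.differentiableAt_zero g z)
  map_smul' c f := Subtype.ext <| funext fun z =>
    deriv_const_mul c (hΦ.differentiableAt_zero f z)

/-- The vector field generating a smooth family at time zero. -/
noncomputable def generator [FiniteDimensional ℝ E] (hΦ : IsSmoothFamily Φ) : VectorFields S :=
  Derivation.mk' hΦ.derivativeMap fun f g => Subtype.ext <| funext fun z => by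
    have h := deriv_fun_mul (hΦ.differentiableAt_zero f z) (hΦ.differentiableAt_zero g z)
    rw [hΦ.zero, Equiv.Perm.one_apply] at h
    change deriv (fun s => (f : S → ℝ) (Φ s z) * (g : S → ℝ) (Φ s z)) 0 =
      (f : S → ℝ) z * deriv (fun s => (g : S → ℝ) (Φ s z)) 0 +
        (g : S → ℝ) z * deriv (fun s => (f : S → ℝ) (Φ s z)) 0
    rw [h]
    ring

theorem hasDerivAt_generator [FiniteDimensional ℝ E] (hΦ : IsSmoothFamily Φ)
    (f : smoothFunctions S) (z : S) :
    HasDerivAt (fun s => (f : S → ℝ) (Φ s z)) ((hΦ.generator f : S → ℝ) z) 0 := by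
  obtain ⟨g, -, -, h⟩ := hΦ.exists_first_order f
  exact (h z).differentiableAt.hasDerivAt

end IsSmoothFamily

/-- The family `Φ` has the expansion `Φ s = id + s ^ k X + O(s ^ (k + 1))`. -/
def HasLeadingTerm (Φ : ℝ → Equiv.Perm S) (k : ℕ) (X : VectorFields S) : Prop :=
  ∀ f : smoothFunctions S, ∃ g : ℝ × S → ℝ, SmoothAlong ∞ (lineProd S) g ∧
    (∀ s z, (f : S → ℝ) (Φ s z) = (f : S → ℝ) z + s ^ k * g (s, z)) ∧
    ∀ z, g (0, z) = (X f : S → ℝ) z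

theorem IsSmoothFamily.hasLeadingTerm_one [FiniteDimensional ℝ E] {Φ : ℝ → Equiv.Perm S}
    (hΦ : IsSmoothFamily Φ) : HasLeadingTerm Φ 1 hΦ.generator := by
  intro f
  obtain ⟨g, hg, h, hd⟩ := hΦ.exists_first_order f
  exact ⟨g, hg, by simpa using h, fun z => (hd z).unique (hΦ.hasDerivAt_generator f z)⟩

namespace HasLeadingTerm

variable {Φ Ψ : ℝ → Equiv.Perm S} {X Y : VectorFields S} {k l : ℕ}

theorem smooth_pow (k : ℕ) : SmoothAlong ∞ (lineProd S) fun p => p.1 ^ k :=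
  ContDiff.smoothAlong (g := fun p : ℝ × E => p.1 ^ k) (contDiff_fst.pow k) _

/-- The expansion of a family applies to functions depending smoothly on the parameter. -/
theorem extend [FiniteDimensional ℝ E] (h : HasLeadingTerm Φ k X) (hΦ : IsSmoothFamily Φ)
    {f : ℝ × S → ℝ} (hf : SmoothAlong ∞ (lineProd S) f) :
    ∃ g : ℝ × S → ℝ, SmoothAlong ∞ (lineProd S) g ∧
      (∀ s z, f (s, Φ s z) = f (s, z) + s ^ k * g (s, z)) ∧
      ∀ z, g (0, z) = (X ⟨_, smoothAlong_initial hf⟩ : S → ℝ) z := by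
  -- Split f(s, ·) = f(0, ·) + s f'(s, ·) by Hadamard. The first part has a remainder of order k by
  -- hypothesis, and the factor s raises the order of the remainder of f' by one.
  have key : ∀ j ≤ k, ∀ f : ℝ × S → ℝ, SmoothAlong ∞ (lineProd S) f →
      ∃ g : ℝ × S → ℝ, SmoothAlong ∞ (lineProd S) g ∧
        ∀ s z, f (s, Φ s z) = f (s, z) + s ^ j * g (s, z) := by
    intro j
    induction j with
    | zero =>
      intro _ f hf
      exact ⟨_, (hΦ.pull hf).sub hf, fun s z => by simp⟩
    | succ j ih =>
      intro hj f hf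
      obtain ⟨f', hf', hff⟩ := hf.hadamard
      obtain ⟨g', hg', hfg⟩ := ih (by omega) f' hf'
      obtain ⟨g₀, hg₀, hfg₀, -⟩ := h ⟨_, smoothAlong_initial hf⟩
      refine ⟨_, ((smooth_pow (k - (j + 1))).mul hg₀).add hg', fun s z => ?_⟩
      have e := hfg₀ s z
      simp only at e
      rw [hff s (Φ s z), hff s z, e, hfg, ← Nat.sub_add_cancel hj, Nat.add_sub_cancel]
      ring
  -- One more splitting: the remainder coming from f' now has order k + 1, so the coefficient of sᵏ
  -- at s = 0 is that of f(0, ·) alone.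
  obtain ⟨f', hf', hff⟩ := hf.hadamard
  obtain ⟨g', hg', hfg⟩ := key k le_rfl f' hf'
  obtain ⟨g₀, hg₀, hfg₀, hX⟩ := h ⟨_, smoothAlong_initial hf⟩
  refine ⟨_, hg₀.add (((smooth_pow 1)).mul hg'), fun s z => ?_, fun z => by simp [hX]⟩
  have e := hfg₀ s z
  simp only at e
  rw [hff s (Φ s z), hff s z, e, hfg]
  ring

theorem reparam (h : HasLeadingTerm Φ k X) (c : ℝ) {j : ℕ} (hj : j ≠ 0) :
    HasLeadingTerm (fun s => Φ (c * s ^ j)) (j * k) (c ^ k • X) := by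
  intro f
  obtain ⟨g, hg, hfg, hX⟩ := h f
  have hr : SmoothAlong ∞ (lineProd S) fun p => lineProd S (c * p.1 ^ j, p.2) :=
    ContDiff.smoothAlong (g := fun p : ℝ × E => (c * p.1 ^ j, p.2))
      (by fun_prop) (lineProd S)
  refine ⟨fun p => c ^ k * g (c * p.1 ^ j, p.2), ?_, fun s z => ?_, fun z => ?_⟩
  · exact (ContDiff.smoothAlong (g := fun _ : ℝ × E => c ^ k) contDiff_const _).mul (hg.comp hr)
  · rw [hfg]
    ring
  · simp [hj, hX]

theorem mul [FiniteDimensional ℝ E] (hX : HasLeadingTerm Φ k X) (hY : HasLeadingTerm Ψ k Y)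
    (hΨ : IsSmoothFamily Ψ) : HasLeadingTerm (fun s => Φ s * Ψ s) k (X + Y) := by
  intro f
  obtain ⟨g, hg, hfg, hgX⟩ := hX f
  obtain ⟨g', hg', hfg', hgY⟩ := hY f
  refine ⟨_, hg'.add (hΨ.pull hg), fun s z => ?_, fun z => ?_⟩
  · rw [Equiv.Perm.mul_apply, hfg, hfg']
    ring
  · simp [hΨ.zero, hgX, hgY, add_comm]

/-- With z = ΨΦw, the value at w of f∘Φ∘Ψ is compared with that of f∘Ψ∘Φ. Both expand to f + sᵏg +
sˡh up to terms of order k + l, whose coefficients at s = 0 are Y(Xf) and X(Yf) respectively. -/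
theorem commutator [FiniteDimensional ℝ E] (hX : HasLeadingTerm Φ k X)
    (hY : HasLeadingTerm Ψ l Y) (hΦ : IsSmoothFamily Φ) (hΨ : IsSmoothFamily Ψ) :
    HasLeadingTerm (fun s => Φ s * Ψ s * (Φ s)⁻¹ * (Ψ s)⁻¹) (k + l) ⁅Y, X⁆ := by
  intro f
  obtain ⟨g, hg, hfg, hgX⟩ := hX f
  obtain ⟨h, hh, hfh, hhY⟩ := hY f
  obtain ⟨g', hg', hfg', hgX'⟩ := hX.extend hΦ hh
  obtain ⟨h', hh', hfh', hhY'⟩ := hY.extend hΨ hg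
  have hΘ := hΦ.inv.mul hΨ.inv
  refine ⟨_, hΘ.pull (hh'.sub hg'), fun s z => ?_, fun z => ?_⟩
  · set w := ((Φ s)⁻¹ * (Ψ s)⁻¹) z with hw
    have hz : z = Ψ s (Φ s w) := by simp [hw]
    have e1 : (Φ s * Ψ s * (Φ s)⁻¹ * (Ψ s)⁻¹) z = Φ s (Ψ s w) := by simp [hw]
    rw [e1]
    conv_rhs => rw [hz]
    rw [hfg, hfh', hfh, hfh, hfg', hfg]
    ring
  · have e1 : (⟨_, smoothAlong_initial hg⟩ : smoothFunctions S) = X f :=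
      Subtype.ext (funext hgX)
    have e2 : (⟨_, smoothAlong_initial hh⟩ : smoothFunctions S) = Y f :=
      Subtype.ext (funext hhY)
    rw [e1] at hhY'
    rw [e2] at hgX'
    simp [hΦ.zero, hΨ.zero, hhY', hgX', Derivation.commutator_apply]

end HasLeadingTerm

end Families

/-! ## Odd roots -/

section OddRoot

theorem Odd.exists_pow_eq {k : ℕ} (hk : Odd k) (c : ℝ) : ∃ r : ℝ, r ^ k = c := by
  have h1 := tendsto_pow_atTop (α := ℝ) hk.pos.ne'
  have h2 : Tendsto (fun x : ℝ => x ^ k) atBot atBot := by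
    have h := tendsto_neg_atTop_atBot.comp (h1.comp tendsto_neg_atBot_atTop)
    refine h.congr fun x => ?_
    simp [hk.neg_pow]
  exact (continuous_pow k).surjective h1 h2 c

/-- The homeomorphism `s ↦ s ^ k` of the line, for odd `k`. -/
noncomputable def oddPowHomeo {k : ℕ} (hk : Odd k) : ℝ ≃ₜ ℝ :=
  (hk.strictMono_pow.orderIsoOfSurjective _ hk.exists_pow_eq).toHomeomorph

/-- The odd root. -/
noncomputable def oddRoot {k : ℕ} (hk : Odd k) : ℝ → ℝ := (oddPowHomeo hk).symm

variable {k : ℕ} (hk : Odd k)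

theorem oddRoot_pow (t : ℝ) : oddRoot hk t ^ k = t := (oddPowHomeo hk).apply_symm_apply t

theorem continuous_oddRoot : Continuous (oddRoot hk) := (oddPowHomeo hk).symm.continuous

theorem oddRoot_zero : oddRoot hk 0 = 0 :=
  pow_eq_zero_iff hk.pos.ne' |>.1 (oddRoot_pow hk 0)

/-- The derivative is written as t^(1/k)/(kt) so that, multiplied by t, it becomes t^(1/k)/k, which
extends continuously to t = 0. -/
theorem hasDerivAt_oddRoot {t : ℝ} (ht : t ≠ 0) :
    HasDerivAt (oddRoot hk) (oddRoot hk t / (k * t)) t := by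
  have h0 : oddRoot hk t ≠ 0 := fun h => ht (by
    rw [← oddRoot_pow hk t, h, zero_pow hk.pos.ne'])
  have hk0 : (k : ℝ) ≠ 0 := by exact_mod_cast hk.pos.ne'
  have h := HasDerivAt.of_local_left_inverse (continuous_oddRoot hk).continuousAt
    (hasDerivAt_pow k (oddRoot hk t)) (by positivity)
    (Eventually.of_forall (oddRoot_pow hk))
  refine h.congr_deriv ?_
  have e : t = oddRoot hk t * oddRoot hk t ^ (k - 1) := by
    rw [← pow_succ', Nat.sub_add_cancel hk.pos, oddRoot_pow]
  rw [inv_eq_one_div, div_eq_div_iff (by positivity) (by positivity)]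
  nth_rewrite 1 [e]
  ring

/-- After the substitution of an odd root, the leading term of a smooth family is still
continuously differentiable. -/
theorem contDiff_mul_oddRoot {E : Type*} [NormedAddCommGroup E] [NormedSpace ℝ E]
    {g : ℝ × E → ℝ} (hg : ContDiff ℝ 1 g) :
    ContDiff ℝ 1 fun p : ℝ × E => p.1 * g (oddRoot hk p.1, p.2) := by
  have hk0 : (k : ℝ) ≠ 0 := by exact_mod_cast hk.pos.ne'
  have hρ : Continuous fun p : ℝ × E => (oddRoot hk p.1, p.2) :=
    ((continuous_oddRoot hk).comp continuous_fst).prodMk continuous_snd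
  have hD := hg.continuous_fderiv one_ne_zero
  -- The product rule off t = 0, with t times the derivative of the root already simplified. In this
  -- form the derivative is visibly continuous at t = 0.
  let D : ℝ × E → (ℝ × E →L[ℝ] ℝ) := fun p =>
    (g (oddRoot hk p.1, p.2) + oddRoot hk p.1 / k * fderiv ℝ g (oddRoot hk p.1, p.2) (1, 0)) •
      ContinuousLinearMap.fst ℝ ℝ E +
    p.1 • (fderiv ℝ g (oddRoot hk p.1, p.2)).comp
      ((ContinuousLinearMap.inr ℝ ℝ E).comp (ContinuousLinearMap.snd ℝ ℝ E))
  refine contDiff_one_iff_hasFDerivAt.2 ⟨D, ?_, ?_⟩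
  · refine Continuous.add (Continuous.smul (f := fun p : ℝ × E => g (oddRoot hk p.1, p.2) +
      oddRoot hk p.1 / k * fderiv ℝ g (oddRoot hk p.1, p.2) (1, 0)) ?_ continuous_const)
      (continuous_fst.smul ((hD.comp hρ).clm_comp continuous_const))
    exact (hg.continuous.comp hρ).add ((((continuous_oddRoot hk).comp continuous_fst).div_const _).mul
      ((hD.comp hρ).clm_apply continuous_const))
  · rintro ⟨t, v⟩
    rcases eq_or_ne t 0 with rfl | ht
    -- At t = 0 the remainder is t (g(t^(1/k), w) - g(0, v)), a product of an O(‖p - (0, v)‖) and an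
    -- o(1).
    · have hD0 : D (0, v) = g (0, v) • ContinuousLinearMap.fst ℝ ℝ E := by
        ext <;> simp [D, oddRoot_zero]
      rw [hD0, hasFDerivAt_iff_isLittleO]
      have h1 : (fun p : ℝ × E => p.1) =O[𝓝 ((0 : ℝ), v)] fun p => ‖p - ((0 : ℝ), v)‖ := by
        have := (ContinuousLinearMap.fst ℝ ℝ E).isBigO_sub (𝓝 ((0 : ℝ), v)) ((0 : ℝ), v)
        simpa using this.norm_right
      have h2 : (fun p : ℝ × E => g (oddRoot hk p.1, p.2) - g (0, v))
          =o[𝓝 ((0 : ℝ), v)] fun _ => (1 : ℝ) := by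
        rw [Asymptotics.isLittleO_one_iff]
        have := ((hg.continuous.comp hρ).sub continuous_const).tendsto' ((0 : ℝ), v) 0
          (f := fun p : ℝ × E => g (oddRoot hk p.1, p.2) - g (0, v)) (by simp [oddRoot_zero])
        exact this
      refine ((h1.mul_isLittleO h2).congr_left fun p => ?_).trans_isBigO ?_
      · simp
        ring
      · simpa using (Asymptotics.isBigO_refl (fun p : ℝ × E => p - ((0 : ℝ), v)) _).norm_left
    · have hf : HasFDerivAt (fun p : ℝ × E => oddRoot hk p.1)
          ((oddRoot hk t / (k * t)) • ContinuousLinearMap.fst ℝ ℝ E) (t, v) :=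
        (hasDerivAt_oddRoot hk ht).comp_hasFDerivAt (t, v) (hasFDerivAt_fst)
      have hG := ((hg.differentiable one_ne_zero (oddRoot hk t, v)).hasFDerivAt).comp (t, v)
        (hf.prodMk (hasFDerivAt_snd (p := (t, v))))
      refine ((hasFDerivAt_fst (p := (t, v))).mul hG).congr_fderiv ?_
      have hsplit : ∀ (a : ℝ) (w : E), fderiv ℝ g (oddRoot hk t, v) (a, w) =
          a * fderiv ℝ g (oddRoot hk t, v) (1, 0) + fderiv ℝ g (oddRoot hk t, v) (0, w) := by
        intro a w
        rw [← smul_eq_mul, ← map_smul, ← map_add]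
        simp
      ext
      · simp [D, hsplit (oddRoot hk t / (k * t)) 0]
        field_simp
        ring
      · simp [D]

end OddRoot

/-! ## Tangent Lie algebras -/

section Tangent

variable {E : Type} [NormedAddCommGroup E] [NormedSpace ℝ E] [FiniteDimensional ℝ E] {S : Set E}

/-- The Lie algebra of the leading terms, of odd order, of the smooth families in `H`. -/
def leadingTerms (H : Subgroup (Equiv.Perm S)) : LieSubalgebra ℝ (VectorFields S) where
  carrier := {X | ∃ k, Odd k ∧ ∃ Φ : ℝ → Equiv.Perm S,
    IsSmoothFamily Φ ∧ (∀ s, Φ s ∈ H) ∧ HasLeadingTerm Φ k X}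
  add_mem' := by
    rintro X Y ⟨k, hk, Φ, hΦ, hΦH, hX⟩ ⟨l, hl, Ψ, hΨ, hΨH, hY⟩
    -- The substitutions s ↦ sˡ and s ↦ sᵏ bring both families to the common odd order kl.
    have hX' := hX.reparam 1 hl.pos.ne'
    have hY' := hY.reparam 1 hk.pos.ne'
    rw [one_pow, one_smul] at hX' hY'
    rw [mul_comm] at hY'
    have hΨ' := hΨ.reparam (r := fun s => 1 * s ^ k) (by fun_prop) (by simp [hk.pos.ne'])
    exact ⟨l * k, hl.mul hk, _, (hΦ.reparam (r := fun s => 1 * s ^ l) (by fun_prop)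
      (by simp [hl.pos.ne'])).mul hΨ', fun s => H.mul_mem (hΦH _) (hΨH _), hX'.mul hY' hΨ'⟩
  zero_mem' := ⟨1, odd_one, fun _ => 1, IsSmoothFamily.one, fun _ => H.one_mem, fun f =>
    ⟨fun _ => 0, (contDiff_const (c := (0 : ℝ))).smoothAlong _, by simp, by simp⟩⟩
  smul_mem' := by
    rintro c X ⟨k, hk, Φ, hΦ, hΦH, hX⟩
    -- Since k is odd, scalars of either sign have a real k-th root, so the scalar can be absorbed
    -- into the parameter.
    obtain ⟨r, rfl⟩ := hk.exists_pow_eq c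
    have hX' := hX.reparam r one_ne_zero
    rw [one_mul] at hX'
    exact ⟨k, hk, _, hΦ.reparam (r := fun s => r * s ^ 1) (by fun_prop) (by simp),
      fun s => hΦH _, hX'⟩
  lie_mem' := by
    rintro X Y ⟨k, hk, Φ, hΦ, hΦH, hX⟩ ⟨l, hl, Ψ, hΨ, hΨH, hY⟩
    -- The plain commutator would have the even order k + l. Squaring one parameter makes it 2l + k,
    -- which is odd.
    have hY' := hY.reparam 1 two_ne_zero
    rw [one_pow, one_smul] at hY'
    have hΨ' := hΨ.reparam (r := fun s => 1 * s ^ 2) (by fun_prop) (by simp)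
    refine ⟨2 * l + k, (even_two_mul l).add_odd hk, _, ?_, fun s => ?_,
      hY'.commutator hX hΨ' hΦ⟩
    · exact ((hΨ'.mul hΦ).mul hΨ'.inv).mul hΦ.inv
    · exact H.mul_mem (H.mul_mem (H.mul_mem (hΨH _) (hΦH _)) (H.inv_mem (hΨH _)))
        (H.inv_mem (hΦH _))

variable {n : ℕ} {S : Set (Fin n → ℝ)}

/-- The coordinate functions of a subset of `ℝⁿ`. -/
def coordFunction (S : Set (Fin n → ℝ)) (i : Fin n) : smoothFunctions S :=
  ⟨fun z => (z : Fin n → ℝ) i, (contDiff_apply ℝ ℝ i).smoothAlong _⟩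

/-- For φ t = Φ(t^(1/k)) every smooth function satisfies f(φ t z) = f(z) + t g(t^(1/k), z). This is
C¹ by `contDiff_mul_oddRoot` and has velocity g(0, z) = (Xf)(z). Oddness makes the root available
for negative t. -/
theorem HasLeadingTerm.isTangentTo {H : Subgroup (Equiv.Perm S)} {X : VectorFields S} {k : ℕ}
    (hk : Odd k) {Φ : ℝ → Equiv.Perm S} (h : HasLeadingTerm Φ k X) (hΦ : IsSmoothFamily Φ)
    (hH : ∀ s, Φ s ∈ H) : IsTangentTo H X := by
  refine ⟨1, one_pos, fun t => Φ (oddRoot hk t), fun t _ => hH _, by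
    simp [oddRoot_zero, hΦ.zero], ?_, fun f z => ?_⟩
  · refine smoothAlong_pi fun i => ?_
    obtain ⟨g, hg, hfg, -⟩ := h (coordFunction S i)
    intro p
    obtain ⟨U, hU, haU, g', hg', hgg'⟩ := hg (oddRoot hk p.1, p.2)
    obtain ⟨G, hG, hGg'⟩ := hg'.exists_contDiff_eventuallyEq hU haU
    obtain ⟨V, hVG, hV, haV⟩ := eventually_nhds_iff.1 hGg'
    have hρ : Continuous fun p : ℝ × (Fin n → ℝ) => (oddRoot hk p.1, p.2) :=
      ((continuous_oddRoot hk).comp continuous_fst).prodMk continuous_snd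
    refine ⟨_, (hU.inter hV).preimage hρ, ⟨haU, haV⟩,
      fun q => q.2 i + q.1 * G (oddRoot hk q.1, q.2), ?_, ?_⟩
    · exact (((contDiff_apply ℝ ℝ i).comp contDiff_snd).add
        (contDiff_mul_oddRoot hk (hG.of_le (by simp)))).contDiffOn
    · rintro ⟨t, z⟩ ⟨h1, h2⟩
      have e := hfg (oddRoot hk t) z
      rw [oddRoot_pow] at e
      refine Eq.trans ?_ e.symm
      change _ + _ * G (oddRoot hk t, (z : Fin n → ℝ)) = _
      rw [hVG _ h2]
      exact congrArg (fun c => (z : Fin n → ℝ) i + t * c) (hgg' (oddRoot hk t, z) h1)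
  · obtain ⟨g, hg, hfg, hX⟩ := h f
    simp only [hfg, oddRoot_pow]
    rw [← hX, hasDerivAt_iff_tendsto_slope_zero]
    have hc : Continuous fun t => g (oddRoot hk t, z) :=
      (hg.contDiff_line z).continuous.comp (continuous_oddRoot hk)
    have ht := hc.tendsto' 0 (g (0, z)) (by rw [oddRoot_zero])
    refine (ht.mono_left nhdsWithin_le_nhds).congr' ?_
    filter_upwards [self_mem_nhdsWithin] with t ht
    have ht : t ≠ 0 := ht
    simp [ht]

theorem isTangentLieAlgebra_leadingTerms (H : Subgroup (Equiv.Perm S)) :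
    IsTangentLieAlgebra H (leadingTerms H) := by
  rintro X ⟨k, hk, Φ, hΦ, hH, hX⟩
  exact hX.isTangentTo hk hΦ hH

end Tangent

/-! ## Finite-dimensional transformation groups have finite-dimensional tangent algebras -/

section LieTransformationGroup

/-- The Hausdorff dimension of the image of a second countable manifold under a smooth map is
at most the dimension of the manifold. -/
theorem ContMDiff.dimH_range_le {d : ℕ} {H : Type*} [TopologicalSpace H]
    [ChartedSpace (EuclideanSpace ℝ (Fin d)) H] [IsManifold (𝓡 d) ∞ H]
    [SecondCountableTopology H] {F : Type*} [NormedAddCommGroup F] [NormedSpace ℝ F]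
    {f : H → F} (hf : ContMDiff (𝓡 d) 𝓘(ℝ, F) ∞ f) : dimH (range f) ≤ d := by
  have hloc : ∀ h : H, ∃ W ∈ 𝓝 h, dimH (f '' W) ≤ d := by
    intro h
    have hg : ContDiffOn ℝ ∞ (f ∘ (extChartAt (𝓡 d) h).symm) (extChartAt (𝓡 d) h).target :=
      (hf.comp_contMDiffOn (contMDiffOn_extChartAt_symm h)).contDiffOn
    obtain ⟨r, hr, hball⟩ := Metric.isOpen_iff.1 (isOpen_extChartAt_target (I := 𝓡 d) h) _
      (mem_extChartAt_target (I := 𝓡 d) h)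
    refine ⟨(extChartAt (𝓡 d) h).source ∩ extChartAt (𝓡 d) h ⁻¹' Metric.ball _ r,
      inter_mem (extChartAt_source_mem_nhds (I := 𝓡 d) h)
        ((continuousAt_extChartAt (I := 𝓡 d) h).preimage_mem_nhds (Metric.ball_mem_nhds _ hr)), ?_⟩
    calc dimH _ ≤ dimH ((f ∘ (extChartAt (𝓡 d) h).symm) ''
          Metric.ball (extChartAt (𝓡 d) h h) r) := by
          refine dimH_mono ?_
          rintro _ ⟨h', ⟨hs, hb⟩, rfl⟩
          exact ⟨_, hb, congrArg f ((extChartAt (𝓡 d) h).left_inv hs)⟩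
      _ ≤ dimH (Metric.ball (extChartAt (𝓡 d) h h) r) :=
          ((hg.mono hball).of_le (by simp)).dimH_image_le (convex_ball _ _) Subset.rfl
      _ ≤ dimH (univ : Set (EuclideanSpace ℝ (Fin d))) := dimH_mono (subset_univ _)
      _ = d := by simp [Real.dimH_univ_eq_finrank]
  choose W hW hdim using hloc
  obtain ⟨s, hs, hsW⟩ := TopologicalSpace.countable_cover_nhds hW
  calc dimH (range f) ≤ dimH (⋃ h ∈ s, f '' W h) := by
        refine dimH_mono ?_
        rintro _ ⟨h, rfl⟩
        obtain ⟨i, hi, hh⟩ := mem_iUnion₂.1 (hsW.symm ▸ mem_univ h : h ∈ ⋃ x ∈ s, W x)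
        exact mem_iUnion₂.2 ⟨i, hi, _, hh, rfl⟩
    _ ≤ d := by
        rw [dimH_bUnion hs]
        exact iSup₂_le fun h _ => hdim h

variable {n : ℕ} {S : Set (Fin n → ℝ)}

/-- The common kernel of a family of functionals is that of finitely many of them. -/
theorem exists_finite_common_kernel {Q V : Type*} [AddCommGroup V] [Module ℝ V]
    [FiniteDimensional ℝ V] (L : Q → Module.Dual ℝ V) :
    ∃ (N : ℕ) (q : Fin N → Q), ∀ c, (∀ i, L (q i) c = 0) → ∀ q', L q' c = 0 := by
  obtain ⟨g, hg, hspan, -⟩ := Submodule.exists_fun_fin_finrank_span_eq ℝ (range L)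
  choose q hq using hg
  refine ⟨_, q, fun c hc q' => ?_⟩
  have hmem : L q' ∈ Submodule.span ℝ (range g) := by
    rw [hspan]
    exact Submodule.subset_span ⟨q', rfl⟩
  refine Submodule.span_induction (p := fun T _ => T c = 0) ?_ rfl ?_ ?_ hmem
  · rintro _ ⟨i, rfl⟩
    rw [← hq, hc]
  · intro T T' _ _ h h'
    rw [LinearMap.add_apply, h, h', add_zero]
  · intro a T _ h
    rw [LinearMap.smul_apply, h, smul_zero]

/-- The value at a point of the derivative of a function along a vector field. -/
noncomputable def evalVectorField (𝔤 : LieSubalgebra ℝ (VectorFields S)) (f : smoothFunctions S)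
    (z : S) : 𝔤 →ₗ[ℝ] ℝ where
  toFun X := ((X : VectorFields S) f : S → ℝ) z
  map_add' _ _ := rfl
  map_smul' _ _ := rfl

/-- Finitely many values of functions separate the linear combinations of linearly independent
vector fields. -/
theorem exists_separating_evaluations {𝔤 : LieSubalgebra ℝ (VectorFields S)} {m : ℕ}
    {X : Fin m → 𝔤} (hX : LinearIndependent ℝ X) :
    ∃ (N : ℕ) (f : Fin N → smoothFunctions S) (z : Fin N → S),
      ∀ c : Fin m → ℝ, (∀ i, ∑ j, c j * evalVectorField 𝔤 (f i) (z i) (X j) = 0) → c = 0 := by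
  obtain ⟨N, q, hq⟩ := exists_finite_common_kernel
    fun (q : smoothFunctions S × S) =>
      (∑ j, evalVectorField 𝔤 q.1 q.2 (X j) • LinearMap.proj j : Module.Dual ℝ (Fin m → ℝ))
  have happ : ∀ (q : smoothFunctions S × S) (c : Fin m → ℝ),
      (∑ j, evalVectorField 𝔤 q.1 q.2 (X j) • LinearMap.proj j : Module.Dual ℝ (Fin m → ℝ)) c =
        ∑ j, c j * evalVectorField 𝔤 q.1 q.2 (X j) := fun q c => by
    simp [mul_comm]
  refine ⟨N, fun i => (q i).1, fun i => (q i).2, fun c hc => ?_⟩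
  have hker := hq c fun i => (happ _ c).trans (hc i)
  refine funext (Fintype.linearIndependent_iff.1 hX c ?_)
  refine Subtype.ext (Derivation.ext fun f => Subtype.ext (funext fun z => ?_))
  suffices h : evalVectorField 𝔤 f z (∑ j, c j • X j) = 0 from h
  rw [map_sum, ← hker (f, z), happ]
  exact Finset.sum_congr rfl fun j _ => map_smul (evalVectorField 𝔤 f z) (c j) (X j)

variable {m : ℕ} {φ : Fin m → ℝ → Equiv.Perm S}

/-- The composition of one-parameter families, each of them with its own parameter. -/
def composeFamilies (φ : Fin m → ℝ → Equiv.Perm S) (l : List (Fin m)) (t : Fin m → ℝ) :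
    Equiv.Perm S :=
  (l.map fun j => φ j (t j)).prod

/-- On a coordinate axis every factor but one is the identity. This yields the partial derivatives
at 0, and `Nodup` ensures that the remaining factor occurs only once. -/
theorem composeFamilies_single (h0 : ∀ j, φ j 0 = 1) {l : List (Fin m)} (hl : l.Nodup)
    (j : Fin m) (τ : ℝ) :
    composeFamilies φ l (Pi.single j τ) = if j ∈ l then φ j τ else 1 := by
  induction l with
  | nil => simp [composeFamilies]
  | cons i l ih =>
    have ih := ih hl.of_cons
    rw [composeFamilies] at ih ⊢
    rw [List.map_cons, List.prod_cons, ih]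
    rcases eq_or_ne j i with rfl | hij
    · simp [(List.nodup_cons.1 hl).1]
    · simp [h0, hij]

theorem composeFamilies_zero (h0 : ∀ j, φ j 0 = 1) (l : List (Fin m)) :
    composeFamilies φ l 0 = 1 := by
  simp [composeFamilies, h0]

theorem contDiffAt_composeFamilies {ε : Fin m → ℝ} (hε : ∀ j, 0 < ε j) (h0 : ∀ j, φ j 0 = 1)
    (hφ : ∀ j, SmoothAlong 1
      (fun p : Ioo (-ε j) (ε j) × S => ((p.1 : ℝ), (p.2 : Fin n → ℝ)))
      (fun p => ((φ j p.1 p.2 : S) : Fin n → ℝ))) (l : List (Fin m)) (z : S) :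
    ContDiffAt ℝ 1 (fun t => ((composeFamilies φ l t z : S) : Fin n → ℝ)) 0 := by
  induction l with
  | nil => exact contDiffAt_const (c := (z : Fin n → ℝ))
  | cons j l ih =>
    obtain ⟨U, hU, haU, g, hg, hgf⟩ := hφ j ⟨⟨0, by simp [hε j]⟩, z⟩
    have hw : ContDiffAt ℝ 1
        (fun t : Fin m → ℝ => (t j, ((composeFamilies φ l t z : S) : Fin n → ℝ))) 0 :=
      (contDiff_apply ℝ ℝ j).contDiffAt.prodMk ih
    have hw0 : ((0 : Fin m → ℝ) j, ((composeFamilies φ l 0 z : S) : Fin n → ℝ)) ∈ U := by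
      simpa [composeFamilies_zero h0] using haU
    refine ((hg.contDiffAt (hU.mem_nhds hw0)).comp (0 : Fin m → ℝ) hw).congr_of_eventuallyEq ?_
    have hj : ∀ᶠ t : Fin m → ℝ in 𝓝 0, t j ∈ Ioo (-ε j) (ε j) :=
      (continuous_apply j).continuousAt.eventually_mem
        (Ioo_mem_nhds (by simp [hε j]) (by simp [hε j]))
    filter_upwards [hj, hw.continuousAt.eventually_mem (hU.mem_nhds hw0)] with t ht htU
    exact (hgf (⟨t j, ht⟩, composeFamilies φ l t z) htU).symm

/-- The families φ are not known to be continuous for the Lie group structure; only evaluations are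
regular. So the contradiction is drawn in a finite-dimensional space of evaluations, by comparing
Hausdorff dimensions. -/
theorem not_isLieTransformationGroup {H : Subgroup (Equiv.Perm S)}
    {𝔤 : LieSubalgebra ℝ (VectorFields S)} (h𝔤 : IsTangentLieAlgebra H 𝔤)
    (hinf : ¬ FiniteDimensional ℝ 𝔤) : ¬ IsLieTransformationGroup H := by
  rintro ⟨d, _, _, _, hLie, hev⟩
  have : IsManifold (𝓡 d) ∞ H := hLie.toIsManifold
  obtain ⟨X, hX⟩ : ∃ X : Fin (d + 1) → 𝔤, LinearIndependent ℝ X := by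
    let B := Module.Basis.ofVectorSpace ℝ 𝔤
    have hB : Infinite (Module.Basis.ofVectorSpaceIndex ℝ 𝔤) :=
      not_finite_iff_infinite.1 fun _ => hinf (Module.Finite.of_basis B)
    exact ⟨_, B.linearIndependent.comp _
      ((Infinite.natEmbedding _).injective.comp Fin.val_injective)⟩
  choose ε hε φ hφH h0 hφ hder using fun j => h𝔤 _ (X j).2
  obtain ⟨N, f, z, hsep⟩ := exists_separating_evaluations hX
  let l := List.finRange (d + 1)
  let T : (Fin (d + 1) → ℝ) →ₗ[ℝ] (Fin N → ℝ) := LinearMap.pi fun i =>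
    ∑ j, evalVectorField 𝔤 (f i) (z i) (X j) • LinearMap.proj j
  have hT : ∀ c i, T c i = ∑ j, c j * evalVectorField 𝔤 (f i) (z i) (X j) := fun c i => by
    simp [T, mul_comm]
  obtain ⟨P, hP⟩ := T.exists_leftInverse_of_injective (LinearMap.ker_eq_bot'.2 fun c hc =>
    hsep c fun i => by rw [← hT, hc]; rfl)
  let Ev : Equiv.Perm S → Fin N → ℝ := fun h i => (f i : S → ℝ) (h (z i))
  have hEv : ContMDiff (𝓡 d) 𝓘(ℝ, Fin N → ℝ) ∞ fun h : H => Ev h := by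
    refine contMDiff_pi_space.2 fun i h => ?_
    obtain ⟨U, hU, haU, g, hg, hgf⟩ := (f i).2 ((h : Equiv.Perm S) (z i))
    have h1 := hev (z i) h
    have h2 := (hg.contDiffAt (hU.mem_nhds haU)).contMDiffAt
    refine (ContMDiffAt.comp (I' := 𝓘(ℝ, Fin n → ℝ)) (g := g)
      (f := fun h : H => (((h : Equiv.Perm S) (z i) : S) : Fin n → ℝ)) h h2
        h1).congr_of_eventuallyEq ?_
    filter_upwards [h1.continuousAt.eventually_mem (hU.mem_nhds haU)] with h' hh'
    exact (hgf _ hh').symm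
  have hF : ContDiffAt ℝ 1 (fun t => Ev (composeFamilies φ l t)) 0 := by
    refine contDiffAt_pi.2 fun i => ?_
    have h1 := contDiffAt_composeFamilies hε h0 hφ l (z i)
    obtain ⟨U, hU, haU, g, hg, hgf⟩ := (f i).2 (composeFamilies φ l 0 (z i))
    have h2 : ContDiffAt ℝ 1 g _ := (hg.contDiffAt (hU.mem_nhds haU)).of_le (by simp)
    refine (ContDiffAt.comp (f := fun t => ((composeFamilies φ l t (z i) : S) : Fin n → ℝ))
      0 h2 h1).congr_of_eventuallyEq ?_
    filter_upwards [h1.continuousAt.eventually_mem (hU.mem_nhds haU)] with t ht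
    exact (hgf _ ht).symm
  -- Differentiability at 0 is already known, so the derivative is determined by its values on the
  -- coordinate axes, where the velocities of the single families appear.
  have hFT : HasFDerivAt (fun t => Ev (composeFamilies φ l t)) T.toContinuousLinearMap 0 := by
    have hd := (hF.differentiableAt one_ne_zero).hasFDerivAt
    refine hd.congr_fderiv ?_
    refine ContinuousLinearMap.coe_injective (LinearMap.pi_ext' fun j => LinearMap.ext_ring ?_)
    ext i
    have hline : HasDerivAt (fun τ : ℝ => (Pi.single j τ : Fin (d + 1) → ℝ)) (Pi.single j 1) 0 :=
      hasDerivAt_pi.2 fun i => by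
        rcases eq_or_ne i j with rfl | hij
        · simpa using hasDerivAt_id' (0 : ℝ)
        · simpa [hij] using hasDerivAt_const (0 : ℝ) (0 : ℝ)
    rw [← Pi.single_zero (M := fun _ : Fin (d + 1) => ℝ) j] at hd
    have h1 := hasDerivAt_pi.1 (hd.comp_hasDerivAt (0 : ℝ) hline) i
    have h2 : HasDerivAt (fun τ : ℝ => Ev (composeFamilies φ l (Pi.single j τ)) i)
        (evalVectorField 𝔤 (f i) (z i) (X j)) 0 := by
      simpa [Ev, composeFamilies_single h0 (List.nodup_finRange _), l] using
        (show HasDerivAt (fun t : ℝ => (f i : S → ℝ) (φ j t (z i)))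
          (evalVectorField 𝔤 (f i) (z i) (X j)) 0 from hder j (f i) (z i))
    have h3 := h2.unique h1
    simpa [hT, Pi.single_apply] using h3.symm
  have hstrict : HasStrictFDerivAt (fun t => P.toContinuousLinearMap (Ev (composeFamilies φ l t)))
      (ContinuousLinearMap.id ℝ (Fin (d + 1) → ℝ)) 0 := by
    have h1 := (hF.hasStrictFDerivAt' hFT one_ne_zero)
    refine (P.toContinuousLinearMap.hasStrictFDerivAt.comp _ h1).congr_fderiv ?_
    ext1 c
    exact LinearMap.congr_fun hP c
  -- A C¹ map with identity derivative at 0 is open there, so its image, which consists of values at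
  -- elements of H, is a neighbourhood in ℝᵈ⁺¹.
  have hnhds := hstrict.map_nhds_eq_of_surj (by simp)
  have hrange : range (fun h : H => P.toContinuousLinearMap (Ev h)) ∈
      𝓝 (P.toContinuousLinearMap (Ev (composeFamilies φ l 0))) := by
    rw [← hnhds, mem_map]
    have hsmall : ∀ᶠ t : Fin (d + 1) → ℝ in 𝓝 0, ∀ j, t j ∈ Ioo (-ε j) (ε j) :=
      eventually_all.2 fun j => (continuous_apply j).continuousAt.eventually_mem
        (Ioo_mem_nhds (by simp [hε j]) (by simp [hε j]))
    filter_upwards [hsmall] with t ht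
    refine ⟨⟨composeFamilies φ l t, H.list_prod_mem fun h hh => ?_⟩, rfl⟩
    obtain ⟨j, -, rfl⟩ := List.mem_map.1 hh
    exact hφH j _ (ht j)
  have h1 := Real.dimH_of_mem_nhds hrange
  have h2 := (P.toContinuousLinearMap.contDiff.contMDiff.comp hEv).dimH_range_le
  rw [Function.comp_def, h1] at h2
  simp at h2
  norm_cast at h2
  omega

end LieTransformationGroup

/-! ## The geodesic coefficients of the Berwald–Moór metric on the Heisenberg group -/

section Metric

/-- The logarithmic derivative of `a b c` in the direction with frame components
`v⁰, v¹ - p v², v²`. -/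
noncomputable def logDirection (p a b c : ℝ) (v : Fin 3 → ℝ) : ℝ :=
  v 0 / a + (v 1 - p * v 2) / b + v 2 / c

/-- The explicit fundamental form of the Berwald–Moór metric. -/
noncomputable def fundForm (p a b c f : ℝ) (v w : Fin 3 → ℝ) : ℝ :=
  f * (2 / 9 * logDirection p a b c v * logDirection p a b c w - 1 / 3 *
    (v 0 * w 0 / a ^ 2 + (v 1 - p * v 2) * (w 1 - p * w 2) / b ^ 2 + v 2 * w 2 / c ^ 2))

variable {x y : Fin 3 → ℝ}

/-- Logarithmic differentiation: dF/F = (2/3) dm/m for F = (m²)^(1/3), whatever the sign of m. -/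
theorem hasDerivAt_cubeRoot_sq {m : ℝ → ℝ} {m' t : ℝ} (hm : HasDerivAt m m' t) (h : m t ≠ 0) :
    HasDerivAt (fun t => (m t ^ 2) ^ (1 / 3 : ℝ))
      (2 / 3 * (m t ^ 2) ^ (1 / 3 : ℝ) * (m' / m t)) t := by
  have h2 : m t ^ 2 ≠ 0 := pow_ne_zero 2 h
  refine ((hm.pow 2).rpow_const (p := (1 / 3 : ℝ)) (Or.inl h2)).congr_deriv ?_
  rw [show (m ^ 2) t = m t ^ 2 from rfl, Real.rpow_sub_one h2]
  field_simp
  norm_num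
  ring

theorem heisCone_iff : y ∈ heisCone x ↔ y 0 ≠ 0 ∧ y 1 - x 0 * y 2 ≠ 0 ∧ y 2 ≠ 0 := by
  simp [heisCone, and_assoc]

theorem eventually_mem_heisCone (h : y ∈ heisCone x) (v w : Fin 3 → ℝ) :
    ∀ᶠ t : ℝ in 𝓝 0, y + t • v ∈ heisCone (x + t • w) := by
  have hc : Continuous fun t : ℝ => (y + t • v) 0 *
      ((y + t • v) 1 - (x + t • w) 0 * (y + t • v) 2) * (y + t • v) 2 := by
    simp only [Pi.add_apply, Pi.smul_apply, smul_eq_mul]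
    fun_prop
  exact hc.continuousAt.eventually_ne (by simpa [heisCone] using h)

/-- Fibre and base point vary together, so that one computation serves both the ∂/∂y and the ∂/∂x
derivatives. -/
theorem hasDerivAt_heisMetric (h : y ∈ heisCone x) (v w : Fin 3 → ℝ) :
    HasDerivAt (fun t : ℝ => heisMetric (x + t • w) (y + t • v))
      (2 / 3 * heisMetric x y * (logDirection (x 0) (y 0) (y 1 - x 0 * y 2) (y 2) v -
        w 0 * y 2 / (y 1 - x 0 * y 2))) 0 := by
  simp only [heisMetric_eq]
  have hl : ∀ (z u : Fin 3 → ℝ) (i : Fin 3),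
      HasDerivAt (fun t : ℝ => (z + t • u) i) (u i) 0 := fun z u i => by
    simpa using ((hasDerivAt_id (0 : ℝ)).mul_const (u i)).const_add (z i)
  have hm := (((hl y v 0).mul ((hl y v 1).sub ((hl x w 0).mul (hl y v 2)))).mul (hl y v 2))
  refine (hasDerivAt_cubeRoot_sq hm ?_).congr_deriv ?_
  · simpa [heisCone] using h
  · obtain ⟨ha, hb, hc⟩ := heisCone_iff.1 h
    simp only [logDirection, zero_smul, add_zero, Pi.mul_apply, Pi.sub_apply]
    congr 1
    field_simp
    ring

theorem lineDeriv_heisMetric (h : y ∈ heisCone x) (v : Fin 3 → ℝ) :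
    lineDeriv ℝ (heisMetric x) y v =
      2 / 3 * heisMetric x y * logDirection (x 0) (y 0) (y 1 - x 0 * y 2) (y 2) v := by
  simpa [lineDeriv] using (hasDerivAt_heisMetric h v 0).deriv

theorem fundTensor_heisMetric (h : y ∈ heisCone x) (i j : Fin 3) :
    fundTensor heisMetric x y i j = fundForm (x 0) (y 0) (y 1 - x 0 * y 2) (y 2)
      (heisMetric x y) (Pi.single i 1) (Pi.single j 1) := by
  generalize hv : (Pi.single i 1 : Fin 3 → ℝ) = v
  generalize hw : (Pi.single j 1 : Fin 3 → ℝ) = w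
  obtain ⟨ha, hb, hc⟩ := heisCone_iff.1 h
  have hl : ∀ i : Fin 3, HasDerivAt (fun t : ℝ => (y + t • v) i) (v i) 0 := fun i => by
    simpa using ((hasDerivAt_id (0 : ℝ)).mul_const (v i)).const_add (y i)
  have hF : HasDerivAt (fun t : ℝ => heisMetric x (y + t • v))
      (2 / 3 * heisMetric x y * logDirection (x 0) (y 0) (y 1 - x 0 * y 2) (y 2) v) 0 := by
    simpa using hasDerivAt_heisMetric h v 0
  have hL : HasDerivAt (fun t : ℝ => logDirection (x 0) ((y + t • v) 0)
      ((y + t • v) 1 - x 0 * (y + t • v) 2) ((y + t • v) 2) w)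
      (-(v 0 * w 0 / y 0 ^ 2 + (v 1 - x 0 * v 2) * (w 1 - x 0 * w 2) / (y 1 - x 0 * y 2) ^ 2 +
        v 2 * w 2 / y 2 ^ 2)) 0 := by
    refine ((((hasDerivAt_const 0 (w 0)).div (hl 0) (by simpa)).add
      ((hasDerivAt_const 0 (w 1 - x 0 * w 2)).div ((hl 1).sub ((hl 2).const_mul (x 0)))
        (by simpa))).add ((hasDerivAt_const 0 (w 2)).div (hl 2) (by simpa))).congr_deriv ?_
    simp
    field_simp
    ring
  have hd := ((hF.const_mul (2 / 3)).mul hL).deriv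
  have he : (fun t : ℝ => lineDeriv ℝ (heisMetric x) (y + t • v) w) =ᶠ[𝓝 0] fun t =>
      2 / 3 * heisMetric x (y + t • v) * logDirection (x 0) ((y + t • v) 0)
        ((y + t • v) 1 - x 0 * (y + t • v) 2) ((y + t • v) 2) w := by
    have := eventually_mem_heisCone h v 0
    simp only [smul_zero, add_zero] at this
    filter_upwards [this] with t ht using lineDeriv_heisMetric ht w
  simp only [fundTensor, Matrix.of_apply, hv, hw]
  rw [lineDeriv, he.deriv_eq]
  refine (congrArg _ hd).trans ?_
  simp only [fundForm, zero_smul, add_zero]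
  ring

/-- The derivative of the fundamental form in the direction of the first base coordinate. -/
noncomputable def fundFormDeriv (p a b c f : ℝ) (v w : Fin 3 → ℝ) : ℝ :=
  -(2 / 3) * (c / b) * fundForm p a b c f v w + f * (2 / 9 *
    (((v 1 - p * v 2) * c - v 2 * b) / b ^ 2 * logDirection p a b c w +
      ((w 1 - p * w 2) * c - w 2 * b) / b ^ 2 * logDirection p a b c v) - 1 / 3 *
    (((v 1 - p * v 2) * c - v 2 * b) / b ^ 2 * ((w 1 - p * w 2) / b) +
      ((w 1 - p * w 2) * c - w 2 * b) / b ^ 2 * ((v 1 - p * v 2) / b)))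

/-- The base point enters the metric only through its coordinate `x 0`. -/
theorem lineDeriv_fundTensor (h : y ∈ heisCone x) (i j k : Fin 3) :
    lineDeriv ℝ (fun u => fundTensor heisMetric u y i j) x (Pi.single k 1) =
      if k = 0 then fundFormDeriv (x 0) (y 0) (y 1 - x 0 * y 2) (y 2)
        (heisMetric x y) (Pi.single i 1) (Pi.single j 1) else 0 := by
  generalize hv : (Pi.single i 1 : Fin 3 → ℝ) = v
  generalize hw : (Pi.single j 1 : Fin 3 → ℝ) = w
  obtain ⟨ha, hb, hc⟩ := heisCone_iff.1 h
  set q : ℝ := (Pi.single k 1 : Fin 3 → ℝ) 0 with hq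
  have he : (fun t : ℝ => fundTensor heisMetric (x + t • Pi.single k 1) y i j) =ᶠ[𝓝 0]
      fun t => fundForm (x 0 + t * q) (y 0) (y 1 - (x 0 + t * q) * y 2) (y 2)
        (heisMetric (x + t • Pi.single k 1) y) v w := by
    have := eventually_mem_heisCone h 0 (Pi.single k 1)
    simp only [smul_zero, add_zero] at this
    filter_upwards [this] with t ht
    rw [fundTensor_heisMetric ht, hv, hw]
    simp [hq]
  rw [lineDeriv, he.deriv_eq]
  have hF : HasDerivAt (fun t : ℝ => heisMetric (x + t • Pi.single k 1) y)
      (2 / 3 * heisMetric x y * (-(q * y 2 / (y 1 - x 0 * y 2)))) 0 := by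
    have := hasDerivAt_heisMetric h 0 (Pi.single k 1)
    simpa [logDirection] using this
  have hp : HasDerivAt (fun t : ℝ => x 0 + t * q) q 0 := by
    simpa using ((hasDerivAt_id (0 : ℝ)).mul_const q).const_add (x 0)
  have hb' : HasDerivAt (fun t : ℝ => y 1 - (x 0 + t * q) * y 2) (-(q * y 2)) 0 := by
    simpa using (hp.mul_const (y 2)).const_sub (y 1)
  have hV : ∀ v : Fin 3 → ℝ, HasDerivAt (fun t : ℝ => v 1 - (x 0 + t * q) * v 2) (-(q * v 2)) 0 :=
    fun v => by simpa using (hp.mul_const (v 2)).const_sub (v 1)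
  have hL : ∀ v : Fin 3 → ℝ, HasDerivAt (fun t : ℝ => logDirection (x 0 + t * q) (y 0)
      (y 1 - (x 0 + t * q) * y 2) (y 2) v) _ 0 := fun v =>
    (((hV v).div hb' (by simpa)).const_add (v 0 / y 0)).add_const (v 2 / y 2)
  have hd := hF.mul ((((hL v).const_mul (2 / 9)).mul (hL w)).sub
    (((((hV v).mul (hV w)).div (hb'.pow 2) (by simpa)).const_add
      (v 0 * w 0 / y 0 ^ 2)).add_const (v 2 * w 2 / y 2 ^ 2) |>.const_mul (1 / 3)))
  refine hd.deriv.trans ?_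
  have hk : q = if k = 0 then 1 else 0 := by
    simp [hq, Pi.single_apply, eq_comm]
  rw [hk]
  split_ifs
  · simp [fundFormDeriv, fundForm, logDirection]
    field_simp
    ring
  · simp

theorem heisMetric_pos (h : y ∈ heisCone x) : 0 < heisMetric x y := by
  rw [heisMetric_eq]
  have h : y 0 * (y 1 - x 0 * y 2) * y 2 ≠ 0 := h
  positivity

/-- In left-invariant components the tensor is f((2/9)ℓℓᵀ - (1/3)D), where ℓ = (1/a, 1/b, 1/c) and D
= diag(1/a², 1/b², 1/c²). The Sherman–Morrison formula gives the inverse f⁻¹(2yyᵀ - 3D⁻¹) with y =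
(a, b, c), and the terms in p come from the change of frame y¹ = b + pc. -/
theorem inv_fundTensor (h : y ∈ heisCone x) {a b c p f : ℝ} (ha : y 0 = a)
    (hb : y 1 - x 0 * y 2 = b) (hc : y 2 = c) (hp : x 0 = p) (hf : heisMetric x y = f) :
    (fundTensor heisMetric x y)⁻¹ = f⁻¹ •
      !![-a ^ 2, 2 * a * b + 2 * p * a * c, 2 * a * c;
        2 * a * b + 2 * p * a * c, -b ^ 2 + 4 * p * b * c - p ^ 2 * c ^ 2, 2 * b * c - p * c ^ 2;
        2 * a * c, 2 * b * c - p * c ^ 2, -c ^ 2] := by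
  obtain ⟨ha0, hb0, hc0⟩ := heisCone_iff.1 h
  have hf0 := (heisMetric_pos h).ne'
  have hg : fundTensor heisMetric x y =
      Matrix.of fun i j => fundForm p a b c f (Pi.single i 1) (Pi.single j 1) := by
    ext i j
    rw [fundTensor_heisMetric h, ha, hb, hc, hp, hf]
    rfl
  rw [hb] at hb0
  rw [ha] at ha0
  rw [hc] at hc0
  rw [hf] at hf0
  refine Matrix.inv_eq_right_inv ?_
  rw [hg]
  ext i j
  fin_cases i <;> fin_cases j <;>
    simp [Matrix.mul_apply, Fin.sum_univ_three, fundForm, logDirection] <;> field_simp <;> ring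

/-- The geodesic coefficients of the metric. -/
theorem geodesicCoeff_heisMetric (h : y ∈ heisCone x) :
    geodesicCoeff heisMetric x y =
      ![-(y 0 ^ 2 * y 2) / (2 * (y 1 - x 0 * y 2)),
        -(y 0 * y 2) / 2 + x 0 * (y 0 * y 2 ^ 2) / (2 * (y 1 - x 0 * y 2)),
        y 0 * y 2 ^ 2 / (2 * (y 1 - x 0 * y 2))] := by
  obtain ⟨ha0, hb0, hc0⟩ := heisCone_iff.1 h
  have hf0 := (heisMetric_pos h).ne'
  ext i
  simp only [geodesicCoeff, lineDeriv_fundTensor h, inv_fundTensor h rfl rfl rfl rfl rfl]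
  generalize hb : y 1 - x 0 * y 2 = b at *
  have hy : y 1 = b + x 0 * y 2 := by rw [← hb]; ring
  generalize heisMetric x y = f at *
  generalize x 0 = p at *
  fin_cases i <;>
    simp [Fin.sum_univ_three, fundFormDeriv, fundForm, logDirection, hy] <;> field_simp <;> ring

end Metric

/-! ## Parallel translation along the lines in the first two coordinate directions -/

section Transport

variable {x y z p q r : Fin 3 → ℝ}

theorem connCoeff_eq_of_hasDerivAt (h : y ∈ heisCone x) {i j : Fin 3} {G : (Fin 3 → ℝ) → ℝ}
    {d : ℝ} (hG : ∀ v ∈ heisCone x, geodesicCoeff heisMetric x v i = G v)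
    (hd : HasDerivAt (fun t : ℝ => G (y + t • Pi.single j 1)) d 0) :
    connCoeff heisMetric x y i j = d := by
  rw [connCoeff, lineDeriv]
  refine (Filter.EventuallyEq.deriv_eq ?_).trans hd.deriv
  have := eventually_mem_heisCone h (Pi.single j 1) 0
  simp only [smul_zero, add_zero] at this
  filter_upwards [this] with t ht using hG _ ht

theorem connCoeff_zero (h : y ∈ heisCone x) (i : Fin 3) :
    connCoeff heisMetric x y i 0 =
      ![-(y 0 * y 2) / (y 1 - x 0 * y 2),
        -(y 2) / 2 + x 0 * y 2 ^ 2 / (2 * (y 1 - x 0 * y 2)),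
        y 2 ^ 2 / (2 * (y 1 - x 0 * y 2))] i := by
  obtain ⟨ha, hb, hc⟩ := heisCone_iff.1 h
  have h0 : HasDerivAt (fun t : ℝ => y 0 + t) 1 0 := (hasDerivAt_id' (0 : ℝ)).const_add (y 0)
  refine connCoeff_eq_of_hasDerivAt h (fun v hv => congrFun (geodesicCoeff_heisMetric hv) i) ?_
  fin_cases i
  · have := ((h0.pow 2).mul_const (y 2)).neg.div_const (2 * (y 1 - x 0 * y 2))
    refine (this.congr_deriv (by simp; field_simp)).congr_of_eventuallyEq (Eventually.of_forall
      fun t => by simp)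
  · have := (h0.mul_const (y 2)).neg.div_const 2 |>.add
      (((h0.mul_const (y 2 ^ 2)).const_mul (x 0)).div_const (2 * (y 1 - x 0 * y 2)))
    refine (this.congr_deriv (by simp)).congr_of_eventuallyEq (Eventually.of_forall
      fun t => by simp)
  · have := (h0.mul_const (y 2 ^ 2)).div_const (2 * (y 1 - x 0 * y 2))
    refine (this.congr_deriv (by simp)).congr_of_eventuallyEq (Eventually.of_forall
      fun t => by simp)

theorem connCoeff_one (h : y ∈ heisCone x) (i : Fin 3) :
    connCoeff heisMetric x y i 1 =
      ![y 0 ^ 2 * y 2 / (2 * (y 1 - x 0 * y 2) ^ 2),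
        -(x 0 * (y 0 * y 2 ^ 2)) / (2 * (y 1 - x 0 * y 2) ^ 2),
        -(y 0 * y 2 ^ 2) / (2 * (y 1 - x 0 * y 2) ^ 2)] i := by
  obtain ⟨ha, hb, hc⟩ := heisCone_iff.1 h
  have h1 : HasDerivAt (fun t : ℝ => 2 * (y 1 + t - x 0 * y 2)) 2 0 := by
    simpa using (((hasDerivAt_id' (0 : ℝ)).const_add (y 1)).sub_const (x 0 * y 2)).const_mul 2
  have hi : ∀ c : ℝ, HasDerivAt (fun t : ℝ => c / (2 * (y 1 + t - x 0 * y 2)))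
      (-c / (2 * (y 1 - x 0 * y 2) ^ 2)) 0 := fun c => by
    refine ((hasDerivAt_const (0 : ℝ) c).div h1 (by simpa)).congr_deriv ?_
    simp
    field_simp
  refine connCoeff_eq_of_hasDerivAt h (fun v hv => congrFun (geodesicCoeff_heisMetric hv) i) ?_
  fin_cases i
  · refine ((hi (-(y 0 ^ 2 * y 2))).congr_deriv (by simp)).congr_of_eventuallyEq
      (Eventually.of_forall fun t => by simp)
  · refine (((hi (x 0 * (y 0 * y 2 ^ 2))).const_add (-(y 0 * y 2) / 2)).congr_deriv
      (by simp)).congr_of_eventuallyEq (Eventually.of_forall fun t => by simp)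
  · refine ((hi (y 0 * y 2 ^ 2)).congr_deriv (by simp)).congr_of_eventuallyEq
      (Eventually.of_forall fun t => by simp)

theorem JoinsPoints.append {n : ℕ} {cs ds : List (ℝ → Fin n → ℝ)} {p q r : Fin n → ℝ}
    (h : JoinsPoints cs p q) (h' : JoinsPoints ds q r) : JoinsPoints (cs ++ ds) p r := by
  induction cs generalizing p with
  | nil => exact (show p = q from h) ▸ h'
  | cons c cs ih => exact ⟨h.1, h.2.1, ih h.2.2⟩

theorem Translates.append {n : ℕ} {F : (Fin n → ℝ) → (Fin n → ℝ) → ℝ}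
    {C : (Fin n → ℝ) → Set (Fin n → ℝ)} {cs ds : List (ℝ → Fin n → ℝ)} {u v w : Fin n → ℝ}
    (h : Translates F C cs u v) (h' : Translates F C ds v w) :
    Translates F C (cs ++ ds) u w := by
  induction cs generalizing u with
  | nil => exact (show u = v from h) ▸ h'
  | cons c cs ih =>
    obtain ⟨X, hX, h0, h1⟩ := h
    exact ⟨X, hX, h0, ih h1⟩

/-- The tangent vector at `p` with the same left-invariant components as `z` at `x`. -/
def leftShift (x p z : Fin 3 → ℝ) : Fin 3 → ℝ :=
  ![z 0, z 1 - x 0 * z 2 + p 0 * z 2, z 2]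

theorem leftShift_self (x z : Fin 3 → ℝ) : leftShift x x z = z := by
  ext i
  fin_cases i <;> simp [leftShift]

theorem leftShift_mem (h : z ∈ heisCone x) : leftShift x p z ∈ heisCone p := by
  simpa [heisCone, leftShift] using h

/-- The transformation `h` of the indicatrix at `x` is the parallel translation, expressed in
left-invariant components, along some curve with displacement `g` from any given point. -/
def IsTransport (x : Fin 3 → ℝ) (h : Equiv.Perm (indicatrix heisMetric x)) (g : Fin 3 → ℝ) :
    Prop :=
  ∀ p, ∃ cs : List (ℝ → Fin 3 → ℝ), JoinsPoints cs p (p + g) ∧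
    ∀ z : indicatrix heisMetric x, Translates heisMetric heisCone cs (leftShift x p z) (leftShift x (p + g) (h z))

variable {h k : Equiv.Perm (indicatrix heisMetric x)} {g g' : Fin 3 → ℝ}

/-- The transport is available from every starting point, so the curve for `h` can be attached where
the curve for `k` ends. -/
theorem IsTransport.mul (hh : IsTransport x h g) (hk : IsTransport x k g') :
    IsTransport x (h * k) (g' + g) := by
  intro p
  obtain ⟨cs, hcs, hcz⟩ := hk p
  obtain ⟨ds, hds, hdz⟩ := hh (p + g')
  rw [add_assoc] at hds hdz
  exact ⟨cs ++ ds, hcs.append hds, fun z => (hcz z).append (hdz (k z))⟩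

theorem IsTransport.mem_holonomyGroup (hh : IsTransport x h 0)
    (hd : h ∈ diffeoGroup (indicatrix heisMetric x)) : h ∈ holonomyGroup heisMetric heisCone x := by
  obtain ⟨cs, hcs, hcz⟩ := hh x
  rw [add_zero] at hcs hcz
  simp only [leftShift_self] at hcz
  exact Subgroup.subset_closure ⟨hd, cs, hcs, hcz⟩

theorem mem_heisCone_of_mem_indicatrix (z : indicatrix heisMetric x) : (z : Fin 3 → ℝ) ∈ heisCone x := by
  intro h
  have hz := z.2
  simp [indicatrix, heisMetric_eq, h] at hz

theorem translates_line {k : Fin 3} {s : ℝ} {X : ℝ → Fin 3 → ℝ}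
    (hX : ∀ t, X t ∈ heisCone (p + t • s • Pi.single k 1))
    (hd : ∀ t, HasDerivAt X
      (fun i => -(connCoeff heisMetric (p + t • s • Pi.single k 1) (X t) i k * s)) t) :
    Translates heisMetric heisCone [fun t => p + t • s • Pi.single k 1] (X 0) (X 1) := by
  refine ⟨X, fun t ht => ⟨hX t, ?_⟩, rfl, rfl⟩
  have hc : HasDerivAt (fun t : ℝ => p + t • s • (Pi.single k 1 : Fin 3 → ℝ))
      (s • Pi.single k 1) t := by
    simpa using ((hasDerivAt_id t).smul_const (s • (Pi.single k 1 : Fin 3 → ℝ))).const_add p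
  have hw := hc.hasDerivWithinAt.derivWithin (uniqueDiffOn_Icc_zero_one t ht)
  refine (hd t).hasDerivWithinAt.congr_deriv ?_
  ext i
  rw [hw]
  simp [Pi.single_apply]

theorem joinsPoints_line (p : Fin 3 → ℝ) (k : Fin 3) (s : ℝ) :
    JoinsPoints [fun t => p + t • s • Pi.single k 1] p (p + s • Pi.single k 1) := by
  refine ⟨?_, by simp, by simp [JoinsPoints]⟩
  fun_prop

end Transport

/-! ## The two flows -/

section Flows

variable {x p z : Fin 3 → ℝ} {s t : ℝ}

/-- The ratio of the last two left-invariant components. -/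
noncomputable def ratioOne (x z : Fin 3 → ℝ) : ℝ := z 2 / (z 1 - x 0 * z 2)

/-- The ratio of the first two left-invariant components. -/
noncomputable def ratioTwo (x z : Fin 3 → ℝ) : ℝ := z 0 / (z 1 - x 0 * z 2)

/-- Parallel translation along the first coordinate line, in left-invariant components. -/
noncomputable def flowOne (x : Fin 3 → ℝ) (s : ℝ) (z : Fin 3 → ℝ) : Fin 3 → ℝ :=
  ![z 0 * Real.exp (s * ratioOne x z), z 1 * Real.exp (-(s * ratioOne x z) / 2),
    z 2 * Real.exp (-(s * ratioOne x z) / 2)]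

/-- Parallel translation along the second coordinate line, in left-invariant components. -/
noncomputable def flowTwo (x : Fin 3 → ℝ) (s : ℝ) (z : Fin 3 → ℝ) : Fin 3 → ℝ :=
  ![z 0 * Real.exp (-(s * (ratioOne x z * ratioTwo x z / 2))),
    z 1 - x 0 * z 2 + x 0 * (z 2 * Real.exp (s * (ratioOne x z * ratioTwo x z / 2))),
    z 2 * Real.exp (s * (ratioOne x z * ratioTwo x z / 2))]

/-- The last two left-invariant components scale by the same factor. The exponent of the flow is
thus conserved, which makes the flow explicit and invertible. -/
theorem ratioOne_flowOne : ratioOne x (flowOne x s z) = ratioOne x z := by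
  have e : ∀ E : ℝ, z 1 * E - x 0 * (z 2 * E) = (z 1 - x 0 * z 2) * E := fun E => by ring
  rw [ratioOne]
  simp only [flowOne, Matrix.cons_val, e]
  exact mul_div_mul_right _ _ (Real.exp_pos _).ne'

theorem ratioTwo_flowOne :
    ratioTwo x (flowOne x s z) = ratioTwo x z * Real.exp (s * (3 / 2 * ratioOne x z)) := by
  have e : ∀ E : ℝ, z 1 * E - x 0 * (z 2 * E) = (z 1 - x 0 * z 2) * E := fun E => by ring
  rw [ratioTwo]
  simp only [flowOne, Matrix.cons_val, e]
  rw [mul_div_mul_comm, ← Real.exp_sub, ratioTwo]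
  congr 2
  ring

theorem component_flowTwo : flowTwo x s z 1 - x 0 * flowTwo x s z 2 = z 1 - x 0 * z 2 := by
  simp [flowTwo]

theorem ratioOne_flowTwo : ratioOne x (flowTwo x s z) =
    ratioOne x z * Real.exp (s * (ratioOne x z * ratioTwo x z / 2)) := by
  rw [ratioOne, component_flowTwo]
  simp only [flowTwo, Matrix.cons_val]
  rw [ratioOne]
  ring

theorem ratioTwo_flowTwo : ratioTwo x (flowTwo x s z) =
    ratioTwo x z * Real.exp (-(s * (ratioOne x z * ratioTwo x z / 2))) := by
  rw [ratioTwo, component_flowTwo]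
  simp only [flowTwo, Matrix.cons_val]
  rw [ratioTwo]
  ring

theorem flowOne_zero : flowOne x 0 z = z := by
  ext i
  fin_cases i <;> simp [flowOne]

theorem flowTwo_zero : flowTwo x 0 z = z := by
  ext i
  fin_cases i <;> simp [flowTwo]

theorem flowOne_neg : flowOne x (-s) (flowOne x s z) = z := by
  rw [flowOne, ratioOne_flowOne]
  ext i
  fin_cases i <;> simp [flowOne, mul_assoc, ← Real.exp_add, neg_div]

theorem flowTwo_neg : flowTwo x (-s) (flowTwo x s z) = z := by
  -- For the second flow the conserved exponent is the product of the two ratios.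
  have e : ratioOne x (flowTwo x s z) * ratioTwo x (flowTwo x s z) =
      ratioOne x z * ratioTwo x z := by
    rw [ratioOne_flowTwo, ratioTwo_flowTwo, mul_mul_mul_comm, ← Real.exp_add, add_neg_cancel,
      Real.exp_zero, mul_one]
  rw [flowTwo, e, component_flowTwo]
  ext i
  fin_cases i <;> simp [flowTwo, mul_assoc, ← Real.exp_add]

theorem heisMetric_flowOne : heisMetric x (flowOne x s z) = heisMetric x z := by
  rw [heisMetric_eq, heisMetric_eq]
  congr 2
  simp only [flowOne, Matrix.cons_val]
  set u := s * ratioOne x z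
  have e : Real.exp u * (Real.exp (-u / 2) * Real.exp (-u / 2)) = 1 := by
    rw [← Real.exp_add, ← Real.exp_add]
    simp
  linear_combination (z 0 * (z 1 - x 0 * z 2) * z 2) * e

theorem heisMetric_flowTwo : heisMetric x (flowTwo x s z) = heisMetric x z := by
  rw [heisMetric_eq, heisMetric_eq, component_flowTwo]
  congr 2
  simp only [flowTwo, Matrix.cons_val]
  set u := s * (ratioOne x z * ratioTwo x z / 2)
  have e : Real.exp (-u) * Real.exp u = 1 := by
    rw [← Real.exp_add]
    simp
  linear_combination (z 0 * (z 1 - x 0 * z 2) * z 2) * e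

/-- The first flow on the indicatrix. -/
noncomputable def permOne (x : Fin 3 → ℝ) (s : ℝ) : Equiv.Perm (indicatrix heisMetric x) where
  toFun z := ⟨flowOne x s z, by simpa [indicatrix, heisMetric_flowOne] using z.2⟩
  invFun z := ⟨flowOne x (-s) z, by simpa [indicatrix, heisMetric_flowOne] using z.2⟩
  left_inv z := Subtype.ext flowOne_neg
  right_inv z := Subtype.ext (by simpa using flowOne_neg (x := x) (s := -s) (z := z))

/-- The second flow on the indicatrix. -/
noncomputable def permTwo (x : Fin 3 → ℝ) (s : ℝ) : Equiv.Perm (indicatrix heisMetric x) where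
  toFun z := ⟨flowTwo x s z, by simpa [indicatrix, heisMetric_flowTwo] using z.2⟩
  invFun z := ⟨flowTwo x (-s) z, by simpa [indicatrix, heisMetric_flowTwo] using z.2⟩
  left_inv z := Subtype.ext flowTwo_neg
  right_inv z := Subtype.ext (by simpa using flowTwo_neg (x := x) (s := -s) (z := z))

theorem permOne_inv : (permOne x s)⁻¹ = permOne x (-s) :=
  Equiv.ext fun _ => rfl

theorem permTwo_inv : (permTwo x s)⁻¹ = permTwo x (-s) :=
  Equiv.ext fun _ => rfl

theorem hasDerivAt_exp_mul (s c t : ℝ) :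
    HasDerivAt (fun t => Real.exp (t * s * c)) (Real.exp (t * s * c) * (s * c)) t := by
  simpa using (((hasDerivAt_id t).mul_const s).mul_const c).exp

/-- In left-invariant components the transport equation reads a' = s a u, b' = -s b u/2, c' = -s c
u/2 with u = c/b constant. The base point has dropped out. -/
theorem isTransport_permOne : IsTransport x (permOne x s) (s • Pi.single 0 1) := by
  intro p
  refine ⟨_, joinsPoints_line p 0 s, fun z => ?_⟩
  obtain ⟨ha, hb, hc⟩ := heisCone_iff.1 (mem_heisCone_of_mem_indicatrix z)
  obtain ⟨z, hz⟩ := z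
  simp only at ha hb hc
  have hmem : ∀ t : ℝ, leftShift x (p + t • s • Pi.single 0 1) (flowOne x (t * s) z) ∈
      heisCone (p + t • s • Pi.single 0 1) := fun t => leftShift_mem (mem_heisCone_of_mem_indicatrix
        (permOne x (t * s) ⟨z, hz⟩))
  have h := translates_line (p := p) (k := 0) (s := s) hmem fun t => ?_
  · simp only [zero_smul, zero_mul, one_smul, one_mul, add_zero, flowOne_zero] at h
    exact h
  · have hE := hasDerivAt_exp_mul s (ratioOne x z) t
    have hE2 : HasDerivAt (fun t => Real.exp (-(t * s * ratioOne x z) / 2))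
        (Real.exp (-(t * s * ratioOne x z) / 2) * (-(s * ratioOne x z) / 2)) t := by
      simpa using ((((hasDerivAt_id t).mul_const s).mul_const (ratioOne x z)).neg.div_const 2).exp
    have hp : HasDerivAt (fun t => p 0 + t * s) s t := by
      simpa using ((hasDerivAt_id t).mul_const s).const_add (p 0)
    have hE20 := (Real.exp_pos (-(t * s * ratioOne x z) / 2)).ne'
    refine hasDerivAt_pi.2 fun i => ?_
    rw [connCoeff_zero (hmem t)]
    have hbt : leftShift x (p + t • s • Pi.single 0 1) (flowOne x (t * s) z) 1 -
        (p + t • s • Pi.single 0 1 : Fin 3 → ℝ) 0 *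
          leftShift x (p + t • s • Pi.single 0 1) (flowOne x (t * s) z) 2 =
        (z 1 - x 0 * z 2) * Real.exp (-(t * s * ratioOne x z) / 2) := by
      simp [leftShift, flowOne]
      ring
    rw [hbt]
    fin_cases i
    · refine ((hE.const_mul (z 0)).congr_deriv ?_).congr_of_eventuallyEq
        (Eventually.of_forall fun t => by simp [leftShift, flowOne])
      simp [leftShift, flowOne, ratioOne]
      field_simp
    · refine ((((hE2.const_mul (z 1)).sub ((hE2.const_mul (z 2)).const_mul (x 0))).add
        (hp.mul (hE2.const_mul (z 2)))).congr_deriv ?_).congr_of_eventuallyEq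
        (Eventually.of_forall fun t => by simp [leftShift, flowOne])
      simp only [leftShift, flowOne, Fin.mk_one, Matrix.cons_val]
      generalize Real.exp (-(t * s * ratioOne x z) / 2) = e at *
      simp only [ratioOne]
      generalize hb' : z 1 - x 0 * z 2 = b at *
      rw [show z 1 = b + x 0 * z 2 by rw [← hb']; ring]
      simp
      field_simp
      ring
    · refine ((hE2.const_mul (z 2)).congr_deriv ?_).congr_of_eventuallyEq
        (Eventually.of_forall fun t => by simp [leftShift, flowOne])
      simp [leftShift, flowOne, ratioOne]
      field_simp

/-- In left-invariant components the transport equation reads a' = -s a uv/2, b' = 0, c' = s c uv/2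
with uv = ac/b² constant, again without the base point. -/
theorem isTransport_permTwo : IsTransport x (permTwo x s) (s • Pi.single 1 1) := by
  intro p
  refine ⟨_, joinsPoints_line p 1 s, fun z => ?_⟩
  obtain ⟨ha, hb, hc⟩ := heisCone_iff.1 (mem_heisCone_of_mem_indicatrix z)
  obtain ⟨z, hz⟩ := z
  simp only at ha hb hc
  have hmem : ∀ t : ℝ, leftShift x (p + t • s • Pi.single 1 1) (flowTwo x (t * s) z) ∈
      heisCone (p + t • s • Pi.single 1 1) := fun t => leftShift_mem (mem_heisCone_of_mem_indicatrix
        (permTwo x (t * s) ⟨z, hz⟩))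
  have h := translates_line (p := p) (k := 1) (s := s) hmem fun t => ?_
  · simp only [zero_smul, zero_mul, one_smul, one_mul, add_zero, flowTwo_zero] at h
    exact h
  · have hE := hasDerivAt_exp_mul s (ratioOne x z * ratioTwo x z / 2) t
    have hE2 : HasDerivAt (fun t => Real.exp (-(t * s * (ratioOne x z * ratioTwo x z / 2))))
        (Real.exp (-(t * s * (ratioOne x z * ratioTwo x z / 2))) *
          -(s * (ratioOne x z * ratioTwo x z / 2))) t := by
      simpa using (((hasDerivAt_id t).mul_const s).mul_const
        (ratioOne x z * ratioTwo x z / 2)).neg.exp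
    -- The connection coefficients multiply a and c, which carry opposite exponentials. This
    -- identity removes the surplus factors in each component below.
    have hEE : Real.exp (t * s * (ratioOne x z * ratioTwo x z / 2)) *
        Real.exp (-(t * s * (ratioOne x z * ratioTwo x z / 2))) = 1 := by
      rw [← Real.exp_add]
      simp
    refine hasDerivAt_pi.2 fun i => ?_
    rw [connCoeff_one (hmem t)]
    have hbt : leftShift x (p + t • s • Pi.single 1 1) (flowTwo x (t * s) z) 1 -
        (p + t • s • Pi.single 1 1 : Fin 3 → ℝ) 0 *
          leftShift x (p + t • s • Pi.single 1 1) (flowTwo x (t * s) z) 2 =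
        z 1 - x 0 * z 2 := by
      simp [leftShift, flowTwo]
    rw [hbt]
    fin_cases i
    · refine ((hE2.const_mul (z 0)).congr_deriv ?_).congr_of_eventuallyEq
        (Eventually.of_forall fun t => by simp [leftShift, flowTwo])
      simp only [leftShift, flowTwo, Fin.zero_eta, Matrix.cons_val]
      generalize Real.exp (t * s * (ratioOne x z * ratioTwo x z / 2)) = e at *
      generalize Real.exp (-(t * s * (ratioOne x z * ratioTwo x z / 2))) = e' at *
      simp only [ratioOne, ratioTwo]
      field_simp
      linear_combination (e' * s / (z 1 - x 0 * z 2) ^ 2) * hEE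
    · refine (((hE.const_mul (z 2)).const_mul (p 0)).const_add
        (z 1 - x 0 * z 2) |>.congr_deriv ?_).congr_of_eventuallyEq
        (Eventually.of_forall fun t => by simp [leftShift, flowTwo])
      simp only [leftShift, flowTwo, Fin.mk_one, Matrix.cons_val]
      generalize Real.exp (t * s * (ratioOne x z * ratioTwo x z / 2)) = e at *
      generalize Real.exp (-(t * s * (ratioOne x z * ratioTwo x z / 2))) = e' at *
      simp [ratioOne, ratioTwo]
      field_simp
      linear_combination (-(p 0 * e * s) / (z 1 - x 0 * z 2) ^ 2) * hEE
    · refine ((hE.const_mul (z 2)).congr_deriv ?_).congr_of_eventuallyEq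
        (Eventually.of_forall fun t => by simp [leftShift, flowTwo])
      simp only [leftShift, flowTwo, Fin.reduceFinMk, Matrix.cons_val]
      generalize Real.exp (t * s * (ratioOne x z * ratioTwo x z / 2)) = e at *
      generalize Real.exp (-(t * s * (ratioOne x z * ratioTwo x z / 2))) = e' at *
      simp only [ratioOne, ratioTwo]
      field_simp
      linear_combination (-(e * s) / (z 1 - x 0 * z 2) ^ 2) * hEE

theorem contDiffOn_flowOne (x : Fin 3 → ℝ) : ContDiffOn ℝ ∞
    (fun q : ℝ × (Fin 3 → ℝ) => flowOne x q.1 q.2) {q | q.2 1 - x 0 * q.2 2 ≠ 0} := by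
  have hc : ∀ i : Fin 3, ContDiff ℝ ∞ fun q : ℝ × (Fin 3 → ℝ) => q.2 i := fun i =>
    (contDiff_apply ℝ ℝ i).comp contDiff_snd
  have hP : ContDiffOn ℝ ∞ (fun q : ℝ × (Fin 3 → ℝ) => q.1 * ratioOne x q.2)
      {q | q.2 1 - x 0 * q.2 2 ≠ 0} := contDiff_fst.contDiffOn.mul
    ((hc 2).contDiffOn.div ((hc 1).sub (contDiff_const.mul (hc 2))).contDiffOn fun q hq => hq)
  refine contDiffOn_pi.2 fun i => ?_
  fin_cases i
  · exact (hc 0).contDiffOn.mul hP.exp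
  · exact (hc 1).contDiffOn.mul (hP.neg.div_const 2).exp
  · exact (hc 2).contDiffOn.mul (hP.neg.div_const 2).exp

theorem contDiffOn_flowTwo (x : Fin 3 → ℝ) : ContDiffOn ℝ ∞
    (fun q : ℝ × (Fin 3 → ℝ) => flowTwo x q.1 q.2) {q | q.2 1 - x 0 * q.2 2 ≠ 0} := by
  have hc : ∀ i : Fin 3, ContDiff ℝ ∞ fun q : ℝ × (Fin 3 → ℝ) => q.2 i := fun i =>
    (contDiff_apply ℝ ℝ i).comp contDiff_snd
  have hb := ((hc 1).sub (contDiff_const.mul (hc 2) (f := fun _ => x 0))).contDiffOn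
    (s := {q | q.2 1 - x 0 * q.2 2 ≠ 0})
  have hP : ContDiffOn ℝ ∞ (fun q : ℝ × (Fin 3 → ℝ) =>
      q.1 * (ratioOne x q.2 * ratioTwo x q.2 / 2)) {q | q.2 1 - x 0 * q.2 2 ≠ 0} :=
    contDiff_fst.contDiffOn.mul ((((hc 2).contDiffOn.div hb fun q hq => hq).mul
      ((hc 0).contDiffOn.div hb fun q hq => hq)).div_const 2)
  refine contDiffOn_pi.2 fun i => ?_
  fin_cases i
  · exact (hc 0).contDiffOn.mul hP.neg.exp
  · exact hb.add (contDiffOn_const.mul ((hc 2).contDiffOn.mul hP.exp))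
  · exact (hc 2).contDiffOn.mul hP.exp

theorem smoothAlong_of_contDiffOn {n : ℕ∞ω} {F : Type*} [NormedAddCommGroup F] [NormedSpace ℝ F]
    {A E : Type*} [NormedAddCommGroup E] [NormedSpace ℝ E] {ι : A → E} {U : Set E} (hU : IsOpen U)
    (hι : ∀ a, ι a ∈ U) {f : E → F} (hf : ContDiffOn ℝ n f U) :
    SmoothAlong n ι fun a => f (ι a) := fun a => ⟨U, hU, hι a, f, hf, fun _ _ => rfl⟩

theorem isOpen_component_ne (x : Fin 3 → ℝ) :
    IsOpen {q : ℝ × (Fin 3 → ℝ) | q.2 1 - x 0 * q.2 2 ≠ 0} := by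
  refine isOpen_ne_fun ?_ continuous_const
  fun_prop

theorem component_ne_zero (z : indicatrix heisMetric x) :
    (z : Fin 3 → ℝ) 1 - x 0 * (z : Fin 3 → ℝ) 2 ≠ 0 :=
  (heisCone_iff.1 (mem_heisCone_of_mem_indicatrix z)).2.1

theorem contDiff_neg_fst : ContDiff ℝ ∞ fun q : ℝ × (Fin 3 → ℝ) => (-q.1, q.2) :=
  contDiff_fst.neg.prodMk contDiff_snd

theorem isSmoothFamily_permOne (x : Fin 3 → ℝ) : IsSmoothFamily (permOne x) where
  zero := Equiv.ext fun z => Subtype.ext <| by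
    exact flowOne_zero
  smooth := smoothAlong_of_contDiffOn (isOpen_component_ne x)
    (fun q => component_ne_zero q.2) (contDiffOn_flowOne x)
  smooth_inv := smoothAlong_of_contDiffOn (isOpen_component_ne x)
    (fun q => component_ne_zero q.2)
    ((contDiffOn_flowOne x).comp contDiff_neg_fst.contDiffOn fun _ hq => hq)

theorem isSmoothFamily_permTwo (x : Fin 3 → ℝ) : IsSmoothFamily (permTwo x) where
  zero := Equiv.ext fun z => Subtype.ext <| by
    exact flowTwo_zero
  smooth := smoothAlong_of_contDiffOn (isOpen_component_ne x)
    (fun q => component_ne_zero q.2) (contDiffOn_flowTwo x)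
  smooth_inv := smoothAlong_of_contDiffOn (isOpen_component_ne x)
    (fun q => component_ne_zero q.2)
    ((contDiffOn_flowTwo x).comp contDiff_neg_fst.contDiffOn fun _ hq => hq)

end Flows

/-! ## Iterated commutators of the two flows -/

section Commutators

variable (x : Fin 3 → ℝ)

/-- Iterated commutators of the second flow with the first one. -/
noncomputable def iterFamily : ℕ → ℝ → Equiv.Perm (indicatrix heisMetric x)
  | 0 => permTwo x
  -- The square keeps all orders odd, as in `leadingTerms`. The factor 1 is the scale in
  -- `HasLeadingTerm.reparam`.
  | n + 1 => fun s => permOne x s * iterFamily n (1 * s ^ 2) * (permOne x s)⁻¹ *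
      (iterFamily n (1 * s ^ 2))⁻¹

/-- The orders of the iterated commutators. -/
def iterOrder : ℕ → ℕ
  | 0 => 1
  | n + 1 => 1 + 2 * iterOrder n

/-- The iterated brackets of the generators of the two flows. -/
noncomputable def iterField : ℕ → VectorFields (indicatrix heisMetric x)
  | 0 => (isSmoothFamily_permTwo x).generator
  | n + 1 => ⁅iterField n, (isSmoothFamily_permOne x).generator⁆

theorem isSmoothFamily_iterFamily (n : ℕ) : IsSmoothFamily (iterFamily x n) := by
  induction n with
  | zero => exact isSmoothFamily_permTwo x
  | succ n ih =>
    have h := ih.reparam (r := fun s => 1 * s ^ 2) (by fun_prop) (by simp)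
    have h1 := isSmoothFamily_permOne x
    exact ((h1.mul h).mul h1.inv).mul h.inv

theorem hasLeadingTerm_iterFamily (n : ℕ) :
    HasLeadingTerm (iterFamily x n) (iterOrder n) (iterField x n) := by
  induction n with
  | zero => exact (isSmoothFamily_permTwo x).hasLeadingTerm_one
  | succ n ih =>
    have h := ih.reparam 1 two_ne_zero
    rw [one_pow, one_smul] at h
    exact (isSmoothFamily_permOne x).hasLeadingTerm_one.commutator h (isSmoothFamily_permOne x)
      ((isSmoothFamily_iterFamily x n).reparam (r := fun s => 1 * s ^ 2) (by fun_prop) (by simp))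

theorem odd_iterOrder (n : ℕ) : Odd (iterOrder n) := by
  cases n with
  | zero => exact odd_one
  | succ n => exact odd_one.add_even (even_two_mul _)

variable {x}

/-- Displacements add in the abelian group ℝ³, so those of a commutator cancel. -/
theorem IsTransport.commutator {h k : Equiv.Perm (indicatrix heisMetric x)} {g g' : Fin 3 → ℝ}
    (hh : IsTransport x h g) (hh' : IsTransport x h⁻¹ (-g)) (hk : IsTransport x k g')
    (hk' : IsTransport x k⁻¹ (-g')) : IsTransport x (h * k * h⁻¹ * k⁻¹) 0 := by
  have := ((hh.mul hk).mul hh').mul hk'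
  rwa [show -g' + (-g + (g' + g)) = 0 by abel] at this

theorem isTransport_permOne_inv (s : ℝ) :
    IsTransport x (permOne x s)⁻¹ (-(s • Pi.single 0 1)) := by
  rw [permOne_inv, ← neg_smul]
  exact isTransport_permOne

theorem isTransport_iterFamily (n : ℕ) (s : ℝ) : ∃ g, IsTransport x (iterFamily x n s) g ∧
    IsTransport x (iterFamily x n s)⁻¹ (-g) ∧ (n ≠ 0 → g = 0) := by
  induction n generalizing s with
  | zero =>
    refine ⟨s • Pi.single 1 1, isTransport_permTwo, ?_, fun h => absurd rfl h⟩
    rw [iterFamily, permTwo_inv, ← neg_smul]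
    exact isTransport_permTwo
  | succ n ih =>
    obtain ⟨g, hg, hg', -⟩ := ih (1 * s ^ 2)
    refine ⟨0, isTransport_permOne.commutator (isTransport_permOne_inv s) hg hg', ?_, fun _ => rfl⟩
    -- The inverse of a commutator is the commutator with the two entries exchanged.
    have h := hg.commutator hg' isTransport_permOne (isTransport_permOne_inv s)
    rw [neg_zero]
    convert h using 1
    simp only [iterFamily]
    group

/-- The index starts at 1 because the second flow itself moves the base point; only its commutators
close up. -/
theorem iterField_mem (n : ℕ) :
    iterField x (n + 1) ∈ leadingTerms (holonomyGroup heisMetric heisCone x) := by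
  refine ⟨_, odd_iterOrder (n + 1), _, isSmoothFamily_iterFamily x _, fun s => ?_,
    hasLeadingTerm_iterFamily x _⟩
  obtain ⟨g, hg, -, h0⟩ := isTransport_iterFamily (x := x) (n + 1) s
  rw [h0 (Nat.succ_ne_zero n)] at hg
  exact hg.mem_holonomyGroup ((isSmoothFamily_iterFamily x _).mem_diffeoGroup s)

theorem contDiffOn_component_inv (x : Fin 3 → ℝ) (i : Fin 3) :
    ContDiffOn ℝ ∞ (fun z : Fin 3 → ℝ => z i / (z 1 - x 0 * z 2)) {z | z 1 - x 0 * z 2 ≠ 0} :=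
  (contDiff_apply ℝ ℝ i).contDiffOn.div ((contDiff_apply ℝ ℝ 1).sub
    (contDiff_const.mul (contDiff_apply ℝ ℝ 2))).contDiffOn fun _ h => h

variable (x)

/-- The first ratio as a smooth function on the indicatrix. -/
noncomputable def ratioFunctionOne : smoothFunctions (indicatrix heisMetric x) :=
  ⟨fun z => ratioOne x z, smoothAlong_of_contDiffOn
    (isOpen_ne_fun (by fun_prop) continuous_const) component_ne_zero (contDiffOn_component_inv x 2)⟩

/-- The second ratio as a smooth function on the indicatrix. -/
noncomputable def ratioFunctionTwo : smoothFunctions (indicatrix heisMetric x) :=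
  ⟨fun z => ratioTwo x z, smoothAlong_of_contDiffOn
    (isOpen_ne_fun (by fun_prop) continuous_const) component_ne_zero (contDiffOn_component_inv x 0)⟩

theorem generator_eq {E : Type} [NormedAddCommGroup E] [NormedSpace ℝ E] [FiniteDimensional ℝ E]
    {S : Set E} {Φ : ℝ → Equiv.Perm S} (hΦ : IsSmoothFamily Φ) {f g : smoothFunctions S}
    (h : ∀ z, HasDerivAt (fun s => (f : S → ℝ) (Φ s z)) ((g : S → ℝ) z) 0) :
    hΦ.generator f = g :=
  Subtype.ext <| funext fun z => (hΦ.hasDerivAt_generator f z).unique (h z)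

theorem hasDerivAt_mul_exp_zero (a c : ℝ) :
    HasDerivAt (fun s => a * Real.exp (s * c)) (a * c) 0 := by
  simpa using (((hasDerivAt_id (0 : ℝ)).mul_const c).exp).const_mul a

theorem generatorOne_ratioOne :
    (isSmoothFamily_permOne x).generator (ratioFunctionOne x) = 0 := by
  refine generator_eq _ fun z => ?_
  have : (fun s => (ratioFunctionOne x : _ → ℝ) (permOne x s z)) = fun _ => ratioOne x z :=
    funext fun s => ratioOne_flowOne
  rw [this]
  exact hasDerivAt_const _ _

theorem generatorOne_ratioTwo : (isSmoothFamily_permOne x).generator (ratioFunctionTwo x) =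
    (3 / 2 : ℝ) • (ratioFunctionOne x * ratioFunctionTwo x) := by
  refine generator_eq _ fun z => ?_
  have : (fun s => (ratioFunctionTwo x : _ → ℝ) (permOne x s z)) =
      fun s => ratioTwo x z * Real.exp (s * (3 / 2 * ratioOne x z)) :=
    funext fun s => ratioTwo_flowOne
  rw [this]
  refine (hasDerivAt_mul_exp_zero _ _).congr_deriv ?_
  change _ = 3 / 2 * (ratioOne x z * ratioTwo x z)
  ring

theorem generatorTwo_ratioOne : (isSmoothFamily_permTwo x).generator (ratioFunctionOne x) =
    (1 / 2 : ℝ) • (ratioFunctionOne x ^ 2 * ratioFunctionTwo x) := by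
  refine generator_eq _ fun z => ?_
  have : (fun s => (ratioFunctionOne x : _ → ℝ) (permTwo x s z)) =
      fun s => ratioOne x z * Real.exp (s * (ratioOne x z * ratioTwo x z / 2)) :=
    funext fun s => ratioOne_flowTwo
  rw [this]
  refine (hasDerivAt_mul_exp_zero _ _).congr_deriv ?_
  change _ = 1 / 2 * (ratioOne x z ^ 2 * ratioTwo x z)
  ring

/-- The first generator annihilates u and multiplies v by (3/2)u, so each bracket contributes a
factor -(3/2)u. -/
theorem iterField_ratioOne (n : ℕ) : iterField x n (ratioFunctionOne x) =
    (1 / 2 * (-3 / 2) ^ n : ℝ) • (ratioFunctionOne x ^ (n + 2) * ratioFunctionTwo x) := by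
  induction n with
  | zero => simpa [iterField] using generatorTwo_ratioOne x
  | succ n ih =>
    rw [iterField, Derivation.commutator_apply, generatorOne_ratioOne, map_zero, ih, Derivation.map_smul,
      Derivation.leibniz, Derivation.leibniz_pow, generatorOne_ratioOne, generatorOne_ratioTwo]
    ext z
    simp
    ring

/-- Points of the indicatrix with prescribed ratios. -/
noncomputable def indicatrixPoint (k : ℝ) (hk : k ≠ 0) : indicatrix heisMetric x :=
  -- The left-invariant components are 1/k, 1, k, with product 1 and ratios u = k, v = 1/k.
  ⟨![k⁻¹, 1 + x 0 * k, k], Or.inl (by simp [heisMetric_eq, hk])⟩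

theorem iterField_apply (n : ℕ) {k : ℝ} (hk : k ≠ 0) :
    (iterField x n (ratioFunctionOne x) : _ → ℝ) (indicatrixPoint x k hk) =
      (1 / 2 * (-3 / 2) ^ n) * k ^ (n + 1) := by
  rw [iterField_ratioOne]
  change _ * (ratioOne x (indicatrixPoint x k hk) ^ (n + 2) *
    ratioTwo x (indicatrixPoint x k hk)) = _
  have h1 : ratioOne x (indicatrixPoint x k hk) = k := by simp [ratioOne, indicatrixPoint]
  have h2 : ratioTwo x (indicatrixPoint x k hk) = k⁻¹ := by simp [ratioTwo, indicatrixPoint]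
  rw [h1, h2, pow_succ k (n + 1), mul_assoc (k ^ (n + 1)), mul_inv_cancel₀ hk, mul_one]

open Polynomial in
theorem eq_zero_of_forall_sum_pow_eq_zero {s : Finset ℕ} {c : ℕ → ℝ}
    (h : ∀ k : ℝ, k ≠ 0 → ∑ n ∈ s, c n * k ^ (n + 2) = 0) {n : ℕ} (hn : n ∈ s) : c n = 0 := by
  let q : ℝ[X] := ∑ n ∈ s, C (c n) * X ^ (n + 2)
  have hq : q = 0 := by
    refine eq_zero_of_infinite_isRoot q (((Set.finite_singleton (0 : ℝ)).infinite_compl).mono ?_)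
    intro k hk
    simpa [q, IsRoot, eval_finsetSum] using h k hk
  have hc : q.coeff (n + 2) = c n := by
    simp [q, finsetSum_coeff, coeff_X_pow, hn]
  rw [← hc, hq, coeff_zero]

/-- A linear relation, applied to u at the points with u = k and v = 1/k, becomes a polynomial
identity in k with one monomial for each field. -/
theorem linearIndependent_iterField : LinearIndependent ℝ fun n : ℕ =>
    (⟨iterField x (n + 1), iterField_mem n⟩ :
      leadingTerms (holonomyGroup heisMetric heisCone x)) := by
  refine linearIndependent_iff'.2 fun s c hc n hn => ?_
  have key : ∀ k : ℝ, k ≠ 0 →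
      ∑ n ∈ s, c n * (1 / 2 * (-3 / 2) ^ (n + 1)) * k ^ (n + 2) = 0 := fun k hk => by
    have h := congrArg (evalVectorField _ (ratioFunctionOne x) (indicatrixPoint x k hk)) hc
    rw [map_sum, map_zero] at h
    rw [← h]
    refine Finset.sum_congr rfl fun n _ => ?_
    rw [map_smul, smul_eq_mul, mul_assoc]
    exact congrArg _ (iterField_apply x (n + 1) hk).symm
  have := eq_zero_of_forall_sum_pow_eq_zero key hn
  simpa using this

end Commutators

theorem mainTheorem7 (x : Fin 3 → ℝ) :
    (∃ 𝔤 : LieSubalgebra ℝ (VectorFields (indicatrix heisMetric x)),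
      IsTangentLieAlgebra (holonomyGroup heisMetric heisCone x) 𝔤 ∧ ¬ FiniteDimensional ℝ 𝔤) ∧
    ¬ IsLieTransformationGroup (holonomyGroup heisMetric heisCone x) := by
  have htan := isTangentLieAlgebra_leadingTerms (holonomyGroup heisMetric heisCone x)
  have hinf : ¬ FiniteDimensional ℝ (leadingTerms (holonomyGroup heisMetric heisCone x)) := by
    intro hfin
    have := (linearIndependent_iterField x).finite
    exact not_finite ℕ
  exact ⟨⟨_, htan, hinf⟩, not_isLieTransformationGroup htan hinf⟩
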